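/- Let $a,b,c$ be positive integers and let $\mathrm{LT}(a,b,c)$ be the (finite) set of lozenge tilings of the hexagon with sides $a,b,c,a,b,c$, with the uniform probability measure $\mathrm{P}$. A tiling is viewed in $\mathbb{R}^3$ as the visible surface of a pile of unit cubes stacked in the corner of the box $[0,b]\times[0,a]\times[0,c]$ (coordinates $x,y,z$): top, left and right tiles are the unit squares orthogonal to the $z$-, $x$- and $y$-axis respectively. A left corner of a tiling is a top tile together with the left tile that hangs directly below the edge of the top tile facing in the positive $x$-direction; its height is the $z$-coordinate of the top tile. Let $\Gamma_\ell$ be the number of left corners of height $\ell$ and, for $1\le k\le c$, let $\Gamma^{(k)}=(\Gamma_1,\dots,\Gamma_k)$. For $\alpha,\beta\in\mathbb{N}^k$ (where $\mathbb{N}=\{0,1,2,\dots\}$) say that $\beta$ dominates $\alpha$, written $\beta\succeq\alpha$, if $\sum_{i=1}^{\ell}\beta_i\ge\sum_{i=1}^{\ell}\alpha_i$ for all $\ell\in[1,k]$ and $\sum_{i=1}^k\alpha_i=\sum_{i=1}^k\beta_i$. Corollary (Monotonicity). Let $1\le k\le c$ and $\alpha,\beta\in\mathbb{N}^k$. If some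 rearrangement of $\beta$ dominates the weakly decreasing rearrangement of $\alpha$ (in particular, if $\alpha$ is weakly decreasing and $\beta\succeq\alpha$), then $$\mathrm{P}(\Gamma^{(k)}=\alpha)\;\ge\;\mathrm{P}(\Gamma^{(k)}=\beta).$$ -/

import Mathlib

open MeasureTheory ProbabilityTheory

/-!  ## Lozenge tilings of a hexagon

The picture plane is `ℝ³` seen along the direction `(1,1,1)`: the lattice point `(x, y, z) ∈ ℤ³` is
drawn at the vertex `(x - z, y - z)` of the triangular lattice, whose vertex set is `ℤ × ℤ` and whose
edges have the directions `(1,0)` (the `x`-axis), `(0,1)` (the `y`-axis) and `(1,1)` (vertical in the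
picture, pointing down: the opposite of the `z`-axis). -/

/-- A unit triangle of the triangular lattice. The unit square with smallest vertex `(u, v)` is cut
by the lattice edge from `(u, v)` to `(u + 1, v + 1)` into the triangles `lower u v` and
`upper u v`. -/
inductive Triangle where
  | lower (u v : ℤ)
  | upper (u v : ℤ)

/-- The three vertices of a unit triangle. -/
def Triangle.vertices : Triangle → Set (ℤ × ℤ)
  | .lower u v => {(u, v), (u + 1, v), (u + 1, v + 1)}
  | .upper u v => {(u, v), (u, v + 1), (u + 1, v + 1)}

/-- The lattice points of the (closed, convex) hexagon with side lengths `a, b, c, a, b, c`, the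
outline of the box `[0, b] × [0, a] × [0, c]` (in the coordinates `x`, `y`, `z`). -/
def hexagon (a b c : ℕ) : Set (ℤ × ℤ) :=
  {p | -(c : ℤ) ≤ p.1 ∧ p.1 ≤ b ∧ -(c : ℤ) ≤ p.2 ∧ p.2 ≤ a ∧ -(a : ℤ) ≤ p.1 - p.2 ∧ p.1 - p.2 ≤ b}

/-- The unit triangles contained in the hexagon. -/
def hexagonTriangles (a b c : ℕ) : Set Triangle :=
  {t | t.vertices ⊆ hexagon a b c}

/-- A lozenge: the union of two unit triangles with a common edge. There are three types, according
to the direction of that edge: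
* `top u v` has vertices `(u, v), (u+1, v), (u, v+1), (u+1, v+1)`, a unit square orthogonal to the
  `z`-axis;
* `left u v` has vertices `(u, v), (u, v+1), (u+1, v+1), (u+1, v+2)`, a unit square orthogonal to
  the `x`-axis;
* `right u v` has vertices `(u, v), (u+1, v), (u+1, v+1), (u+2, v+1)`, a unit square orthogonal to
  the `y`-axis. -/
inductive Lozenge where
  | top (u v : ℤ)
  | left (u v : ℤ)
  | right (u v : ℤ)

/-- The two unit triangles that make up a lozenge. -/
def Lozenge.triangles : Lozenge → Set Triangle
  | .top u v => {.lower u v, .upper u v}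
  | .left u v => {.upper u v, .lower u (v + 1)}
  | .right u v => {.lower u v, .upper (u + 1) v}

/-- A finite set of lozenges tiles the hexagon if all its lozenges lie in the hexagon and every unit
triangle of the hexagon lies in exactly one of them. -/
def IsLozengeTiling (a b c : ℕ) (T : Finset Lozenge) : Prop :=
  (∀ L ∈ T, L.triangles ⊆ hexagonTriangles a b c) ∧
    ∀ t ∈ hexagonTriangles a b c, ∃! L : Lozenge, L ∈ T ∧ t ∈ L.triangles

/-- `lozengeTilings a b c`: the set of lozenge tilings of the hexagon with sides `a, b, c, a, b, c`. -/
def lozengeTilings (a b c : ℕ) : Set (Finset Lozenge) :=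
  {T | IsLozengeTiling a b c T}

/-- The height (`z`-coordinate) of the top tile `top u v` of a tiling `T`, seen as a pile of cubes
in `ℝ³`. Go down in the picture from the lowest vertex `(u + 1, v + 1)` of the tile to the boundary
of the hexagon, where `z = 0`. A unit segment on the way is either the short diagonal of a top tile,
along which `z` does not change, or a vertical edge of tiles, along which `z` decreases by `1`. So
the height is the number of segments of the second kind. -/
noncomputable def topHeight (a b c : ℕ) (T : Finset Lozenge) (u v : ℤ) : ℕ :=
  Set.ncard {s : ℤ | 1 ≤ s ∧ (u + s, v + s) ∈ hexagon a b c ∧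
    (u + s + 1, v + s + 1) ∈ hexagon a b c ∧ Lozenge.top (u + s) (v + s) ∉ T}

/-- `T` has a left corner at `p`: a top tile `top p.1 p.2` together with the left tile that hangs
below its left (lower-left in the picture) edge, the edge from `(p.1 + 1, p.2)` to
`(p.1 + 1, p.2 + 1)`. -/
def IsLeftCorner (T : Finset Lozenge) (p : ℤ × ℤ) : Prop :=
  Lozenge.top p.1 p.2 ∈ T ∧ Lozenge.left (p.1 + 1) p.2 ∈ T

/-- `Γ_ℓ(T)`: the number of left corners of height `ℓ` of the tiling `T`. -/
noncomputable def cornerCount (a b c : ℕ) (ℓ : ℕ) (T : Finset Lozenge) : ℕ :=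
  Set.ncard {p : ℤ × ℤ | IsLeftCorner T p ∧ topHeight a b c T p.1 p.2 = ℓ}

/-- `Γ^(k) = (Γ_1, …, Γ_k)`. -/
noncomputable def cornerVector (a b c k : ℕ) (T : Finset Lozenge) : Fin k → ℕ :=
  fun i => cornerCount a b c ((i : ℕ) + 1) T

instance : MeasurableSpace (Finset Lozenge) := ⊤

instance : DiscreteMeasurableSpace (Finset Lozenge) := ⟨fun _ => trivial⟩

/-- The uniform probability measure on `lozengeTilings a b c`. -/
noncomputable def tilingMeasure (a b c : ℕ) : Measure (Finset Lozenge) :=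
  uniformOn (lozengeTilings a b c)

theorem lozengeTilings_finite (a b c : ℕ) : (lozengeTilings a b c).Finite := by
  classical
  let I : Set (ℤ × ℤ) := Set.Icc (-(c : ℤ), -(c : ℤ)) ((b : ℤ), (a : ℤ))
  have hI : I.Finite := Set.finite_Icc _ _
  let B : Set Lozenge := (fun p : ℤ × ℤ => Lozenge.top p.1 p.2) '' I ∪
    ((fun p : ℤ × ℤ => Lozenge.left p.1 p.2) '' I ∪ (fun p : ℤ × ℤ => Lozenge.right p.1 p.2) '' I)
  have hB : B.Finite := (hI.image _).union ((hI.image _).union (hI.image _))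
  have key : ∀ T ∈ lozengeTilings a b c, (T : Set Lozenge) ⊆ B := by
    intro T hT L hL
    have h := hT.1 L hL
    have aux : ∀ u v : ℤ, (u, v) ∈ hexagon a b c → (u, v) ∈ I := by
      intro u v huv
      simp only [hexagon, Set.mem_setOf_eq] at huv
      exact ⟨⟨huv.1, huv.2.2.1⟩, ⟨huv.2.1, huv.2.2.2.1⟩⟩
    rcases L with ⟨u, v⟩ | ⟨u, v⟩ | ⟨u, v⟩
    · have h1 : Triangle.lower u v ∈ hexagonTriangles a b c := h (by simp [Lozenge.triangles])
      exact Or.inl ⟨(u, v), aux u v (h1 (by simp [Triangle.vertices])), rfl⟩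
    · have h1 : Triangle.upper u v ∈ hexagonTriangles a b c := h (by simp [Lozenge.triangles])
      exact Or.inr (Or.inl ⟨(u, v), aux u v (h1 (by simp [Triangle.vertices])), rfl⟩)
    · have h1 : Triangle.lower u v ∈ hexagonTriangles a b c := h (by simp [Lozenge.triangles])
      exact Or.inr (Or.inr ⟨(u, v), aux u v (h1 (by simp [Triangle.vertices])), rfl⟩)
  refine (hB.toFinset.powerset.finite_toSet).subset fun T hT => ?_
  simp only [Finset.coe_powerset, Set.mem_preimage, Set.mem_powerset_iff, Set.Finite.coe_toFinset]
  exact key T hT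

/-- The tiling given by the empty pile of cubes. -/
theorem lozengeTilings_nonempty (a b c : ℕ) : (lozengeTilings a b c).Nonempty := by
  classical
  let S : Set Lozenge := {L | match L with
    | .top u v => 0 ≤ u ∧ u < b ∧ 0 ≤ v ∧ v < a
    | .left u v => -(c : ℤ) ≤ u ∧ u < 0 ∧ 0 ≤ v - u ∧ v - u < a
    | .right u v => -(c : ℤ) ≤ v ∧ v < 0 ∧ 0 ≤ u - v ∧ u - v < b}
  let I : Set (ℤ × ℤ) := Set.Icc (-(c : ℤ), -(c : ℤ)) ((b : ℤ), (a : ℤ))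
  have hI : I.Finite := Set.finite_Icc _ _
  have hS : S.Finite := by
    refine ((hI.image fun p : ℤ × ℤ => Lozenge.top p.1 p.2).union
      ((hI.image fun p : ℤ × ℤ => Lozenge.left p.1 p.2).union
        (hI.image fun p : ℤ × ℤ => Lozenge.right p.1 p.2))).subset ?_
    rintro (⟨u, v⟩ | ⟨u, v⟩ | ⟨u, v⟩) h <;> simp only [S, Set.mem_setOf_eq] at h
    · exact Or.inl ⟨(u, v), ⟨⟨by simp only; omega, by simp only; omega⟩,
        ⟨by simp only; omega, by simp only; omega⟩⟩, rfl⟩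
    · exact Or.inr (Or.inl ⟨(u, v), ⟨⟨by simp only; omega, by simp only; omega⟩,
        ⟨by simp only; omega, by simp only; omega⟩⟩, rfl⟩)
    · exact Or.inr (Or.inr ⟨(u, v), ⟨⟨by simp only; omega, by simp only; omega⟩,
        ⟨by simp only; omega, by simp only; omega⟩⟩, rfl⟩)
  refine ⟨hS.toFinset, ?_, ?_⟩
  · rintro (⟨u, v⟩ | ⟨u, v⟩ | ⟨u, v⟩) h <;>
      simp only [S, Set.Finite.mem_toFinset, Set.mem_setOf_eq] at h <;>
      simp only [Lozenge.triangles, hexagonTriangles, Triangle.vertices, hexagon,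
        Set.insert_subset_iff, Set.singleton_subset_iff, Set.mem_setOf_eq] <;> omega
  · rintro (⟨u, v⟩ | ⟨u, v⟩) h <;>
      simp only [hexagonTriangles, Triangle.vertices, hexagon,
        Set.insert_subset_iff, Set.singleton_subset_iff, Set.mem_setOf_eq] at h
    · by_cases h1 : 0 ≤ u ∧ 0 ≤ v
      · refine ⟨.top u v, by simp [S, Lozenge.triangles]; omega, ?_⟩
        rintro (⟨u', v'⟩ | ⟨u', v'⟩ | ⟨u', v'⟩) h' <;> simp [S, Lozenge.triangles] at h' ⊢ <;> omega
      by_cases h2 : u < v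
      · refine ⟨.left u (v - 1), by simp [S, Lozenge.triangles]; omega, ?_⟩
        rintro (⟨u', v'⟩ | ⟨u', v'⟩ | ⟨u', v'⟩) h' <;> simp [S, Lozenge.triangles] at h' ⊢ <;> omega
      · refine ⟨.right u v, by simp [S, Lozenge.triangles]; omega, ?_⟩
        rintro (⟨u', v'⟩ | ⟨u', v'⟩ | ⟨u', v'⟩) h' <;> simp [S, Lozenge.triangles] at h' ⊢ <;> omega
    · by_cases h1 : 0 ≤ u ∧ 0 ≤ v
      · refine ⟨.top u v, by simp [S, Lozenge.triangles]; omega, ?_⟩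
        rintro (⟨u', v'⟩ | ⟨u', v'⟩ | ⟨u', v'⟩) h' <;> simp [S, Lozenge.triangles] at h' ⊢ <;> omega
      by_cases h2 : u ≤ v
      · refine ⟨.left u v, by simp [S, Lozenge.triangles]; omega, ?_⟩
        rintro (⟨u', v'⟩ | ⟨u', v'⟩ | ⟨u', v'⟩) h' <;> simp [S, Lozenge.triangles] at h' ⊢ <;> omega
      · refine ⟨.right (u - 1) v, by simp [S, Lozenge.triangles]; omega, ?_⟩
        rintro (⟨u', v'⟩ | ⟨u', v'⟩ | ⟨u', v'⟩) h' <;> simp [S, Lozenge.triangles] at h' ⊢ <;> omega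

instance (a b c : ℕ) : IsProbabilityMeasure (tilingMeasure a b c) :=
  isProbabilityMeasure_uniformOn (lozengeTilings_finite a b c) (lozengeTilings_nonempty a b c)

/-- For `α, β ∈ ℕ^k`: `β` dominates `α`, written `β ⪰ α`. -/
def Dominates {k : ℕ} (β α : Fin k → ℕ) : Prop :=
  (∀ l : Fin k, ∑ i ∈ Finset.Iic l, α i ≤ ∑ i ∈ Finset.Iic l, β i) ∧ ∑ i, α i = ∑ i, β i

/-! ## Last passage times and the crystal operators on two adjacent rows -/

/-! Cut the pile of cubes into columns parallel to the `y`-axis, one for each pair `(x, z)`. The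
column depths satisfy the recursion of last passage percolation: each depth is the larger of the
depths of its neighbours at `x + 1` and at `z + 1`, plus the number of left corners found there.
Recording the corner numbers therefore turns tilings bijectively into `c` by `b` matrices with
entries in `ℕ` and last passage time at most `a` (`bijOn_cornerMatrix`). Height `ℓ` becomes row `c -
ℓ`, so `Γ_ℓ` is the sum of that row (`IsLozengeTiling.cornerCount_eq`). It remains to compare the
numbers `N(v)` of such matrices whose last `k` row sums are `v`.

The comparison uses a crystal operator on two adjacent rows: one unit drops from the upper to the
lower row, in the first column where an up-to-down turn is most profitable. Last passage times below
the two rows do not change (`CrystalMove.lppRow_eq`), and the move can be undone, because its column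
becomes the last one of maximal gain. If the upper row has the larger sum, the move is always
defined, so `N` does not decrease when a unit passes from a larger entry to a smaller adjacent one.
Repeating the move as often as the two sums differ is a bijection that exchanges these sums, so `N`
is symmetric. Hence adjacency is not needed (`ncard_rowSumMatrices_le_of_transfer`), and a vector
that dominates a weakly decreasing one reaches it by such transfers (`Dominates.le_of_transfer`). -/

/-- One row of last passage times, given the weights `w` of the row and the last passage times `g`
of the previous row. -/
def lppRow (w g : ℕ → ℕ) : ℕ → ℕ
  | 0 => 0
  | n + 1 => w n + max (lppRow w g n) (g (n + 1))

/-- Last passage times of a matrix of weights: `lpp W t n` is the maximal weight of a directed path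
in the first `t` rows and `n` columns. -/
def lpp (W : ℕ → ℕ → ℕ) : ℕ → ℕ → ℕ
  | 0 => fun _ => 0
  | t + 1 => lppRow (W t) (lpp W t)

/-- The sum of the first `n` terms, as an integer. -/
def prefixSum (w : ℕ → ℕ) (n : ℕ) : ℤ := ∑ m ∈ Finset.range n, (w m : ℤ)

theorem prefixSum_succ (w : ℕ → ℕ) (n : ℕ) : prefixSum w (n + 1) = prefixSum w n + w n :=
  Finset.sum_range_succ _ _

theorem prefixSum_zero (w : ℕ → ℕ) : prefixSum w 0 = 0 := rfl

/-- A path that enters the row in column `j` collects `g (j + 1)` before and the weights of the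
columns `j, ..., n` after. The maximum over `j` is described by its upper bounds, which leaves only
linear arithmetic for later use. -/
theorem lppRow_succ_le_iff (w g : ℕ → ℕ) (n : ℕ) (t : ℤ) :
    (lppRow w g (n + 1) : ℤ) ≤ t ↔
      ∀ j ≤ n, prefixSum w (n + 1) - prefixSum w j + g (j + 1) ≤ t := by
  induction n generalizing t with
  | zero => simp [lppRow, prefixSum]
  | succ n ih =>
    have h : (lppRow w g (n + 1 + 1) : ℤ) ≤ t ↔
        (lppRow w g (n + 1) : ℤ) ≤ t - w (n + 1) ∧ (g (n + 1 + 1) : ℤ) ≤ t - w (n + 1) := by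
      rw [lppRow]; omega
    rw [h, ih]
    have e := prefixSum_succ w (n + 1)
    constructor
    · rintro ⟨h1, h2⟩ j hj
      rcases Nat.lt_or_ge n j with hj' | hj'
      · obtain rfl : j = n + 1 := by omega
        omega
      · have := h1 j hj'
        omega
    · intro h
      refine ⟨fun j hj => ?_, ?_⟩
      · have := h j (by omega)
        omega
      · have := h (n + 1) le_rfl
        omega

/-- The gain of a path that changes from row `v` to row `u` in column `j`. -/
def turnGain (v u : ℕ → ℕ) (j : ℕ) : ℤ := prefixSum v (j + 1) - prefixSum u j

theorem lppRow_lppRow_succ_le_iff (v u g : ℕ → ℕ) (n : ℕ) (t : ℤ) :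
    (lppRow u (lppRow v g) (n + 1) : ℤ) ≤ t ↔
      ∀ j ≤ n, ∀ i ≤ j,
        prefixSum u (n + 1) - prefixSum v i + turnGain v u j + g (i + 1) ≤ t := by
  rw [lppRow_succ_le_iff]
  refine forall₂_congr fun j hj => ?_
  have : prefixSum u (n + 1) - prefixSum u j + (lppRow v g (j + 1) : ℤ) ≤ t ↔
      (lppRow v g (j + 1) : ℤ) ≤ t - (prefixSum u (n + 1) - prefixSum u j) := by omega
  rw [this, lppRow_succ_le_iff]
  refine forall₂_congr fun i hi => ?_
  simp only [turnGain]
  omega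

/-- `(v', u')` arises from `(v, u)` by the crystal operator that moves one unit from `v` to `u`,
in the first column `p < b` where the turn gain is maximal. -/
structure CrystalMove (b : ℕ) (v u v' u' : ℕ → ℕ) (p : ℕ) : Prop where
  lt : p < b
  from_eq : v p = v' p + 1
  to_eq : u' p = u p + 1
  from_ne : ∀ n, n ≠ p → v' n = v n
  to_ne : ∀ n, n ≠ p → u' n = u n
  before : ∀ j < p, turnGain v u j < turnGain v u p
  after : ∀ j < b, p < j → turnGain v u j ≤ turnGain v u p

theorem prefixSum_eq_add_ite {w w' : ℕ → ℕ} {p : ℕ} (hp : w' p = w p + 1)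
    (hne : ∀ n, n ≠ p → w' n = w n) (n : ℕ) :
    prefixSum w' n = prefixSum w n + if p < n then 1 else 0 := by
  induction n with
  | zero => simp [prefixSum]
  | succ n ih =>
    rw [prefixSum_succ, prefixSum_succ, ih]
    rcases eq_or_ne n p with rfl | h
    · simp [hp]; ring
    · rw [hne n h]
      split_ifs <;> omega

namespace CrystalMove

variable {b : ℕ} {v u v' u' : ℕ → ℕ} {p : ℕ}

theorem prefixSum_to (h : CrystalMove b v u v' u' p) (n : ℕ) :
    prefixSum u' n = prefixSum u n + if p < n then 1 else 0 :=
  prefixSum_eq_add_ite h.to_eq h.to_ne n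

theorem prefixSum_from (h : CrystalMove b v u v' u' p) (n : ℕ) :
    prefixSum v n = prefixSum v' n + if p < n then 1 else 0 :=
  prefixSum_eq_add_ite h.from_eq (fun n hn => (h.from_ne n hn).symm) n

/-- The move costs nothing before `p`, one at `p` and two after `p`. This is what turns the first
maximum into the last one. -/
theorem turnGain_eq (h : CrystalMove b v u v' u' p) (j : ℕ) :
    turnGain v u j = turnGain v' u' j + (if p ≤ j then 1 else 0) + if p < j then 1 else 0 := by
  simp only [turnGain]
  rw [h.prefixSum_to j, h.prefixSum_from (j + 1)]
  split_ifs <;> omega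

/-- For `p ≤ n`, only two kinds of paths change weight. Those turning before `p` gain one, but were
strictly worse than the path with the same entry turning at `p`. Those entering at or before `p` and
turning after it lose one, but were no better than that path. The path turning at `p` keeps its
weight, so the maximum stays. -/
theorem lppRow_eq (h : CrystalMove b v u v' u' p) (g : ℕ → ℕ) {n : ℕ} (hn : n ≤ b) :
    lppRow u' (lppRow v' g) n = lppRow u (lppRow v g) n := by
  rcases n with _ | n
  · rfl
  have key : ∀ t : ℤ, (lppRow u' (lppRow v' g) (n + 1) : ℤ) ≤ t ↔
      (lppRow u (lppRow v g) (n + 1) : ℤ) ≤ t := by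
    intro t
    rw [lppRow_lppRow_succ_le_iff, lppRow_lppRow_succ_le_iff]
    have hG := h.turnGain_eq
    have hu := h.prefixSum_to (n + 1)
    have hp := hG p
    constructor
    · intro H j hj i hi
      have hv := h.prefixSum_from i
      have hjG := hG j
      have h1 := H j hj i hi
      -- The competitor: same entry column `i`, turn at `p`.
      have h2 := fun hpn hip => H p hpn i hip
      have h3 := h.before j
      have h4 := h.after j
      split_ifs at * <;> omega
    · intro H j hj i hi
      have hv := h.prefixSum_from i
      have hjG := hG j
      have h1 := H j hj i hi
      have h2 := fun hpn hip => H p hpn i hip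
      have h3 := h.before j
      have h4 := h.after j
      split_ifs at * <;> omega
  have h1 := (key _).1 le_rfl
  have h2 := (key _).2 le_rfl
  omega

theorem before' (h : CrystalMove b v u v' u' p) (j : ℕ) (hj : j < p) :
    turnGain v' u' j ≤ turnGain v' u' p := by
  have h1 := h.turnGain_eq j
  have h2 := h.turnGain_eq p
  have h3 := h.before j
  split_ifs at * <;> omega

theorem after' (h : CrystalMove b v u v' u' p) (j : ℕ) (hj : j < b) (hpj : p < j) :
    turnGain v' u' j < turnGain v' u' p := by
  have h1 := h.turnGain_eq j
  have h2 := h.turnGain_eq p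
  have h3 := h.after j
  split_ifs at * <;> omega

theorem ext_right {v'' u'' : ℕ → ℕ} {q : ℕ} (h : CrystalMove b v u v' u' p)
    (h' : CrystalMove b v u v'' u'' q) : v' = v'' ∧ u' = u'' := by
  obtain rfl : p = q := by
    rcases lt_trichotomy p q with hpq | hpq | hpq
    · have := h'.before p hpq
      have := h.after q h'.lt hpq
      omega
    · exact hpq
    · have := h.before q hpq
      have := h'.after p h.lt hpq
      omega
  refine ⟨funext fun n => ?_, funext fun n => ?_⟩
  · rcases eq_or_ne n p with rfl | hn
    · have := h.from_eq
      have := h'.from_eq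
      omega
    · rw [h.from_ne n hn, h'.from_ne n hn]
  · rcases eq_or_ne n p with rfl | hn
    · have := h.to_eq
      have := h'.to_eq
      omega
    · rw [h.to_ne n hn, h'.to_ne n hn]

/-- After the move, `p` can be read off as the last column of maximal gain (`before'`, `after'`), so
the move is injective. -/
theorem ext_left {v₀ u₀ : ℕ → ℕ} {q : ℕ} (h : CrystalMove b v u v' u' p)
    (h' : CrystalMove b v₀ u₀ v' u' q) : v = v₀ ∧ u = u₀ := by
  obtain rfl : p = q := by
    rcases lt_trichotomy p q with hpq | hpq | hpq
    · have := h'.before' p hpq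
      have := h.after' q h'.lt hpq
      omega
    · exact hpq
    · have := h.before' q hpq
      have := h'.after' p h.lt hpq
      omega
  refine ⟨funext fun n => ?_, funext fun n => ?_⟩
  · rcases eq_or_ne n p with rfl | hn
    · have := h.from_eq
      have := h'.from_eq
      omega
    · rw [← h.from_ne n hn, ← h'.from_ne n hn]
  · rcases eq_or_ne n p with rfl | hn
    · have := h.to_eq
      have := h'.to_eq
      omega
    · rw [← h.to_ne n hn, ← h'.to_ne n hn]

end CrystalMove

theorem exists_first_max (f : ℕ → ℤ) {b : ℕ} (hb : 0 < b) :
    ∃ p < b, (∀ j < p, f j < f p) ∧ ∀ j < b, f j ≤ f p := by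
  induction b with
  | zero => omega
  | succ b ih =>
    rcases Nat.eq_zero_or_pos b with rfl | hb'
    · refine ⟨0, by omega, by omega, fun j hj => ?_⟩
      obtain rfl : j = 0 := by omega
      exact le_rfl
    obtain ⟨p, hp, h1, h2⟩ := ih hb'
    rcases le_or_gt (f b) (f p) with h | h
    · refine ⟨p, by omega, h1, fun j hj => ?_⟩
      rcases Nat.lt_succ_iff_lt_or_eq.1 hj with hj | rfl
      · exact h2 j hj
      · exact h
    · refine ⟨b, by omega, fun j hj => (h2 j hj).trans_lt h, fun j hj => ?_⟩
      rcases Nat.lt_succ_iff_lt_or_eq.1 hj with hj | rfl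
      · exact ((h2 j hj).trans_lt h).le
      · exact le_rfl

theorem exists_last_max (f : ℕ → ℤ) {b : ℕ} (hb : 0 < b) :
    ∃ p < b, (∀ j < b, p < j → f j < f p) ∧ ∀ j < b, f j ≤ f p := by
  obtain ⟨p, hp, h1, h2⟩ := exists_first_max (fun j => f (b - 1 - j)) hb
  refine ⟨b - 1 - p, by omega, fun j hj hpj => ?_, fun j hj => ?_⟩
  · have := h1 (b - 1 - j) (by omega)
    rwa [show b - 1 - (b - 1 - j) = j by omega] at this
  · have := h2 (b - 1 - j) (by omega)
    rwa [show b - 1 - (b - 1 - j) = j by omega] at this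

theorem turnGain_succ (v u : ℕ → ℕ) (j : ℕ) :
    turnGain v u (j + 1) = turnGain v u j + v (j + 1) - u j := by
  simp only [turnGain, prefixSum_succ]
  ring

theorem exists_crystalMove_right {b : ℕ} {v u : ℕ → ℕ} (h : ∃ j < b, 0 < turnGain v u j) :
    ∃ v' u' p, CrystalMove b v u v' u' p := by
  obtain ⟨j, hj, hpos⟩ := h
  obtain ⟨p, hp, h1, h2⟩ := exists_first_max (turnGain v u) (b := b) (by omega)
  -- A unit must be available. For `p = 0` the gain is `v 0` itself; otherwise the strict increase
  -- of the gain from `p - 1` to `p` forces `v p > u (p - 1)`.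
  have hv : 0 < v p := by
    rcases p with _ | p
    · have := h2 j hj
      simp only [turnGain, prefixSum_succ, prefixSum_zero] at *
      omega
    · have := h1 p (by omega)
      rw [turnGain_succ] at this
      omega
  refine ⟨Function.update v p (v p - 1), Function.update u p (u p + 1), p, hp, ?_, ?_, ?_, ?_, h1,
    fun j hj _ => h2 j hj⟩
  · simp; omega
  · simp
  · intro n hn; simp [hn]
  · intro n hn; simp [hn]

theorem exists_crystalMove_left {b : ℕ} {v' u' : ℕ → ℕ}
    (h : ∃ j < b, prefixSum v' b - prefixSum u' b < turnGain v' u' j) :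
    ∃ v u p, CrystalMove b v u v' u' p := by
  obtain ⟨j, hj, hpos⟩ := h
  obtain ⟨p, hp, h1, h2⟩ := exists_last_max (turnGain v' u') (b := b) (by omega)
  -- Either `p` is the last column, where the gain exceeds the difference of the row sums by exactly
  -- `u' p`, or the gain drops strictly from `p` to `p + 1`, which forces `u' p > v' (p + 1)`.
  have hu : 0 < u' p := by
    rcases eq_or_lt_of_le (Nat.succ_le_of_lt hp) with rfl | hpb
    · have := h2 j hj
      simp only [Nat.succ_eq_add_one, prefixSum_succ] at *
      simp only [turnGain, prefixSum_succ] at *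
      omega
    · have := h1 (p + 1) hpb (by omega)
      rw [turnGain_succ] at this
      omega
  have e1 : ∀ n, prefixSum (Function.update v' p (v' p + 1)) n =
      prefixSum v' n + if p < n then 1 else 0 :=
    prefixSum_eq_add_ite (by simp) fun n hn => by simp [hn]
  have e2 : ∀ n, prefixSum u' n =
      prefixSum (Function.update u' p (u' p - 1)) n + if p < n then 1 else 0 :=
    prefixSum_eq_add_ite (by simp; omega) fun n hn => by simp [hn]
  refine ⟨Function.update v' p (v' p + 1), Function.update u' p (u' p - 1), p, hp, ?_, ?_, ?_, ?_,
    ?_, ?_⟩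
  · simp
  · simp; omega
  · intro n hn; simp [hn]
  · intro n hn; simp [hn]
  · intro j hj
    have := h2 j (by omega)
    have a1 := e1 (j + 1)
    have a2 := e2 j
    have a3 := e1 (p + 1)
    have a4 := e2 p
    simp only [turnGain] at *
    split_ifs at * <;> omega
  · intro j hj hpj
    have := h1 j hj hpj
    have a1 := e1 (j + 1)
    have a2 := e2 j
    have a3 := e1 (p + 1)
    have a4 := e2 p
    simp only [turnGain] at *
    split_ifs at * <;> omega

theorem lppRow_congr {w g g' : ℕ → ℕ} {n : ℕ} (h : ∀ m ≤ n, g m = g' m) :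
    lppRow w g n = lppRow w g' n := by
  induction n with
  | zero => rfl
  | succ n ih => rw [lppRow, lppRow, ih fun m hm => h m (by omega), h _ le_rfl]

theorem lpp_succ_succ (W : ℕ → ℕ → ℕ) (t n : ℕ) :
    lpp W (t + 1) (n + 1) = W t n + max (lpp W (t + 1) n) (lpp W t (n + 1)) := rfl

theorem lpp_apply_zero (W : ℕ → ℕ → ℕ) (t : ℕ) : lpp W t 0 = 0 := by
  cases t <;> rfl

theorem lpp_mono_right (W : ℕ → ℕ → ℕ) (t : ℕ) : Monotone (lpp W t) := by
  refine monotone_nat_of_le_succ fun n => ?_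
  cases t with
  | zero => rfl
  | succ t => rw [lpp_succ_succ]; omega

theorem lpp_mono_left (W : ℕ → ℕ → ℕ) (n : ℕ) : Monotone fun t => lpp W t n := by
  refine monotone_nat_of_le_succ fun t => ?_
  cases n with
  | zero => simp [lpp_apply_zero]
  | succ n => rw [lpp_succ_succ]; omega

/-! ### Matrices with bounded last passage time -/

/-- The matrices with `c` rows, `b` columns and last passage time at most `a`. -/
def lppMatrices (a b c : ℕ) : Set (ℕ → ℕ → ℕ) :=
  {W | (∀ t n, c ≤ t ∨ b ≤ n → W t n = 0) ∧ lpp W c b ≤ a}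

theorem lppMatrices_finite (a b c : ℕ) : (lppMatrices a b c).Finite := by
  have hle : ∀ W ∈ lppMatrices a b c, ∀ t n, W t n < a + 1 := by
    rintro W ⟨h0, ha⟩ t n
    by_cases h : c ≤ t ∨ b ≤ n
    · rw [h0 t n h]; omega
    · have h1 : lpp W (t + 1) (n + 1) ≤ lpp W (t + 1) b := lpp_mono_right W _ (by omega)
      have h2 : lpp W (t + 1) b ≤ lpp W c b := lpp_mono_left W b (by omega)
      rw [lpp_succ_succ] at h1
      omega
  let f : lppMatrices a b c → (Fin c → Fin b → Fin (a + 1)) :=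
    fun W t n => ⟨W.1 t n, hle W.1 W.2 t n⟩
  have hf : Function.Injective f := by
    rintro ⟨W, hW⟩ ⟨W', hW'⟩ h
    refine Subtype.ext (funext fun t => funext fun n => ?_)
    by_cases htn : c ≤ t ∨ b ≤ n
    · exact (hW.1 t n htn).trans (hW'.1 t n htn).symm
    · have := congrFun (congrFun h ⟨t, by omega⟩) ⟨n, by omega⟩
      exact congrArg Fin.val this
  have := Finite.of_injective f hf
  exact Set.toFinite _

/-- `W'` arises from `W` by the crystal operator on the rows `t` and `t + 1`. -/
def MatrixMove (b t : ℕ) (W W' : ℕ → ℕ → ℕ) : Prop :=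
  (∃ p, CrystalMove b (W t) (W (t + 1)) (W' t) (W' (t + 1)) p) ∧
    ∀ s, s ≠ t → s ≠ t + 1 → W' s = W s

namespace MatrixMove

variable {a b c t : ℕ} {W W' : ℕ → ℕ → ℕ}

theorem lpp_eq_of_le (h : MatrixMove b t W W') {s : ℕ} (hs : s ≤ t) : lpp W' s = lpp W s := by
  induction s with
  | zero => rfl
  | succ s ih => rw [lpp, lpp, ih (by omega), h.2 s (by omega) (by omega)]

/-- The two changed rows act on the times above them as before, and every later row sees only the
times of its predecessor. The bound `n ≤ b` is needed because the gain at `p` is maximal only among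
the first `b` columns. -/
theorem lpp_eq (h : MatrixMove b t W W') {s n : ℕ} (hs : t + 2 ≤ s) (hn : n ≤ b) :
    lpp W' s n = lpp W s n := by
  induction s, hs using Nat.le_induction generalizing n with
  | base =>
    obtain ⟨p, hp⟩ := h.1
    have := h.lpp_eq_of_le le_rfl
    change lppRow (W' (t + 1)) (lppRow (W' t) (lpp W' t)) n = _
    rw [this]
    exact hp.lppRow_eq _ hn
  | succ s hs ih =>
    rw [lpp, lpp, h.2 s (by omega) (by omega)]
    exact lppRow_congr fun m hm => ih (hm.trans hn)

theorem mem_iff (h : MatrixMove b t W W') (htc : t + 1 < c) :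
    W' ∈ lppMatrices a b c ↔ W ∈ lppMatrices a b c := by
  unfold lppMatrices
  rw [Set.mem_ofPred_eq, Set.mem_ofPred_eq, h.lpp_eq htc le_rfl]
  refine and_congr_left fun _ => forall₂_congr fun s n => forall_congr' fun hsn => ?_
  obtain ⟨⟨p, hp⟩, hne⟩ := h
  have := hp.lt
  by_cases h1 : s = t
  · subst h1
    rw [hp.from_ne n (by omega)]
  by_cases h2 : s = t + 1
  · subst h2
    rw [hp.to_ne n (by omega)]
  rw [hne s h1 h2]

theorem sum_from (h : MatrixMove b t W W') :
    ∑ n ∈ Finset.range b, W t n = ∑ n ∈ Finset.range b, W' t n + 1 := by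
  obtain ⟨⟨p, hp⟩, -⟩ := h
  have := hp.prefixSum_from b
  rw [if_pos hp.lt] at this
  simp only [prefixSum] at this
  exact_mod_cast this

theorem sum_to (h : MatrixMove b t W W') :
    ∑ n ∈ Finset.range b, W' (t + 1) n = ∑ n ∈ Finset.range b, W (t + 1) n + 1 := by
  obtain ⟨⟨p, hp⟩, -⟩ := h
  have := hp.prefixSum_to b
  rw [if_pos hp.lt] at this
  simp only [prefixSum] at this
  exact_mod_cast this

theorem ext_right {W'' : ℕ → ℕ → ℕ} (h : MatrixMove b t W W') (h' : MatrixMove b t W W'') :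
    W' = W'' := by
  obtain ⟨⟨p, hp⟩, hne⟩ := h
  obtain ⟨⟨q, hq⟩, hne'⟩ := h'
  obtain ⟨e1, e2⟩ := hp.ext_right hq
  funext s
  by_cases h1 : s = t
  · subst h1; exact e1
  by_cases h2 : s = t + 1
  · subst h2; exact e2
  rw [hne s h1 h2, hne' s h1 h2]

theorem ext_left {W₀ : ℕ → ℕ → ℕ} (h : MatrixMove b t W W') (h' : MatrixMove b t W₀ W') :
    W = W₀ := by
  obtain ⟨⟨p, hp⟩, hne⟩ := h
  obtain ⟨⟨q, hq⟩, hne'⟩ := h'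
  obtain ⟨e1, e2⟩ := hp.ext_left hq
  funext s
  by_cases h1 : s = t
  · subst h1; exact e1
  by_cases h2 : s = t + 1
  · subst h2; exact e2
  rw [← hne s h1 h2, ← hne' s h1 h2]

theorem exists_right (h : ∃ j < b, 0 < turnGain (W t) (W (t + 1)) j) :
    ∃ W', MatrixMove b t W W' := by
  obtain ⟨v, u, p, hp⟩ := exists_crystalMove_right h
  refine ⟨Function.update (Function.update W t v) (t + 1) u, ⟨p, ?_⟩, fun s h1 h2 => ?_⟩
  · simpa using hp
  · simp [h1, h2]

theorem exists_left (h : ∃ j < b, prefixSum (W' t) b - prefixSum (W' (t + 1)) b <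
    turnGain (W' t) (W' (t + 1)) j) : ∃ W, MatrixMove b t W W' := by
  obtain ⟨v, u, p, hp⟩ := exists_crystalMove_left h
  refine ⟨Function.update (Function.update W' t v) (t + 1) u, ⟨p, ?_⟩, fun s h1 h2 => ?_⟩
  · simpa using hp
  · simp [h1, h2]

end MatrixMove

/-! ### Counting matrices by row sums -/

/-- The matrices in `lppMatrices a b c` whose last `k` rows have the sums `v`, from the last row
upwards. -/
def rowSumMatrices (a b c : ℕ) {k : ℕ} (v : Fin k → ℕ) : Set (ℕ → ℕ → ℕ) :=
  {W | W ∈ lppMatrices a b c ∧ ∀ i : Fin k, ∑ n ∈ Finset.range b, W (c - 1 - i) n = v i}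

/-- The matrices in `rowSumMatrices a b c v` whose maximal turn gain between the rows `t` and `t + 1`
is at least `s`. -/
def gainMatrices (a b c t : ℕ) (s : ℤ) {k : ℕ} (v : Fin k → ℕ) : Set (ℕ → ℕ → ℕ) :=
  {W | W ∈ rowSumMatrices a b c v ∧ ∃ j < b, s ≤ turnGain (W t) (W (t + 1)) j}

theorem rowSumMatrices_finite (a b c : ℕ) {k : ℕ} (v : Fin k → ℕ) :
    (rowSumMatrices a b c v).Finite :=
  (lppMatrices_finite a b c).subset fun _ h => h.1

theorem gainMatrices_finite (a b c t : ℕ) (s : ℤ) {k : ℕ} (v : Fin k → ℕ) :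
    (gainMatrices a b c t s v).Finite :=
  (rowSumMatrices_finite a b c v).subset fun _ h => h.1

/-- `v'` arises from `v` by moving `r` units from the entry `j` to the entry `i`. -/
structure Transfer {k : ℕ} (i j : Fin k) (r : ℕ) (v v' : Fin k → ℕ) : Prop where
  from_eq : v j = v' j + r
  to_eq : v' i = v i + r
  ne : ∀ l, l ≠ i → l ≠ j → v' l = v l

section Adjacent

variable {a b c k : ℕ} {i j : Fin k} {v v' : Fin k → ℕ}

theorem MatrixMove.mem_gainMatrices_right (hkc : k ≤ c) (hij : (j : ℕ) = i + 1)
    (hv : Transfer i j 1 v v') {s : ℤ} {W W' : ℕ → ℕ → ℕ} (h : MatrixMove b (c - 1 - j) W W')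
    (hW : W ∈ gainMatrices a b c (c - 1 - j) (s + 1) v) :
    W' ∈ gainMatrices a b c (c - 1 - j) s v' := by
  have hj := j.2
  have hi : c - 1 - j + 1 = c - 1 - i := by omega
  obtain ⟨⟨hM, hsum⟩, q, hq, hgain⟩ := hW
  refine ⟨⟨(h.mem_iff (by omega)).2 hM, fun l => ?_⟩, ?_⟩
  · by_cases hli : l = i
    · subst hli
      have := h.sum_to
      rw [hi, hsum] at this
      rw [this, hv.to_eq]
    by_cases hlj : l = j
    · subst hlj
      have := h.sum_from
      rw [hsum, hv.from_eq] at this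
      omega
    · rw [h.2 _ (by omega) (by omega), hsum, hv.ne l hli hlj]
  · obtain ⟨p, hp⟩ := h.1
    refine ⟨p, hp.lt, ?_⟩
    have h1 := hp.turnGain_eq p
    have h2 := hp.before q
    have h3 := hp.after q hq
    rcases lt_trichotomy q p with hqp | rfl | hqp
    all_goals simp at h1; omega

theorem MatrixMove.mem_gainMatrices_left (hkc : k ≤ c) (hij : (j : ℕ) = i + 1)
    (hv : Transfer i j 1 v v') {s : ℤ} {W W' : ℕ → ℕ → ℕ} (h : MatrixMove b (c - 1 - j) W W')
    (hW : W' ∈ gainMatrices a b c (c - 1 - j) s v') :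
    W ∈ gainMatrices a b c (c - 1 - j) (s + 1) v := by
  have hj := j.2
  have hi : c - 1 - j + 1 = c - 1 - i := by omega
  obtain ⟨⟨hM, hsum⟩, q, hq, hgain⟩ := hW
  refine ⟨⟨(h.mem_iff (by omega)).1 hM, fun l => ?_⟩, ?_⟩
  · by_cases hli : l = i
    · subst hli
      have := h.sum_to
      rw [hi, hsum, hv.to_eq] at this
      omega
    by_cases hlj : l = j
    · subst hlj
      have := h.sum_from
      rw [hsum] at this
      rw [this, hv.from_eq]
    · rw [← h.2 _ (by omega) (by omega), hsum, hv.ne l hli hlj]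
  · obtain ⟨p, hp⟩ := h.1
    refine ⟨p, hp.lt, ?_⟩
    have h1 := hp.turnGain_eq p
    have h2 := hp.before' q
    have h3 := hp.after' q hq
    rcases lt_trichotomy q p with hqp | rfl | hqp
    all_goals simp at h1; omega

/-- A maximal gain of at least `s + 1 > 0` makes the move possible; it lowers this maximum by one
and is injective. -/
theorem ncard_gainMatrices_le (hkc : k ≤ c) (hij : (j : ℕ) = i + 1) (hv : Transfer i j 1 v v')
    {s : ℤ} (hs : 0 ≤ s) :
    (gainMatrices a b c (c - 1 - j) (s + 1) v).ncard ≤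
      (gainMatrices a b c (c - 1 - j) s v').ncard := by
  have hex : ∀ W ∈ gainMatrices a b c (c - 1 - j) (s + 1) v,
      ∃ W', MatrixMove b (c - 1 - j) W W' := by
    rintro W ⟨-, q, hq, hgain⟩
    exact MatrixMove.exists_right ⟨q, hq, by omega⟩
  choose! f hf using hex
  refine Set.ncard_le_ncard_of_injOn f
    (fun W hW => (hf W hW).mem_gainMatrices_right hkc hij hv hW) (fun W hW W₀ hW₀ h => ?_)
    (gainMatrices_finite a b c _ s v')
  exact (hf W hW).ext_left (h ▸ hf W₀ hW₀)

/-- The inverse move needs a gain above the difference of the row sums, and `hs'` puts the threshold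
`s` there. -/
theorem ncard_gainMatrices_ge (hkc : k ≤ c) (hij : (j : ℕ) = i + 1) (hv : Transfer i j 1 v v')
    {s : ℤ} (hs' : (v' j : ℤ) < s + v' i) :
    (gainMatrices a b c (c - 1 - j) s v').ncard ≤
      (gainMatrices a b c (c - 1 - j) (s + 1) v).ncard := by
  have hj := j.2
  have hi : c - 1 - j + 1 = c - 1 - i := by omega
  have hex : ∀ W' ∈ gainMatrices a b c (c - 1 - j) s v',
      ∃ W, MatrixMove b (c - 1 - j) W W' := by
    rintro W ⟨⟨-, hsum⟩, q, hq, hgain⟩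
    refine MatrixMove.exists_left ⟨q, hq, ?_⟩
    have h1 : prefixSum (W (c - 1 - j)) b = v' j := by rw [← hsum j]; simp [prefixSum]
    have h2 : prefixSum (W (c - 1 - j + 1)) b = v' i := by rw [← hsum i, hi]; simp [prefixSum]
    omega
  choose! f hf using hex
  refine Set.ncard_le_ncard_of_injOn f
    (fun W hW => (hf W hW).mem_gainMatrices_left hkc hij hv hW) (fun W hW W₀ hW₀ h => ?_)
    (gainMatrices_finite a b c _ _ v)
  exact (hf W hW).ext_right (h ▸ hf W₀ hW₀)

/-- Turning in the first column gains at least `0`, and turning in the last column gains at least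
the difference of the two row sums. Thresholds up to either value exclude nothing. -/
theorem gainMatrices_eq (hb : 0 < b) (hkc : k ≤ c) (hij : (j : ℕ) = i + 1) {s : ℤ}
    (hs : s ≤ 0 ∨ s ≤ (v j : ℤ) - v i) :
    gainMatrices a b c (c - 1 - j) s v = rowSumMatrices a b c v := by
  have hj := j.2
  have hi : c - 1 - j + 1 = c - 1 - i := by omega
  refine Set.Subset.antisymm (fun W hW => hW.1) fun W hW => ⟨hW, ?_⟩
  rcases hs with hs | hs
  · refine ⟨0, hb, ?_⟩
    simp only [turnGain, prefixSum_succ, prefixSum_zero]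
    omega
  · refine ⟨b - 1, by omega, ?_⟩
    have h1 : prefixSum (W (c - 1 - j)) b = v j := by rw [← hW.2 j]; simp [prefixSum]
    have h2 : prefixSum (W (c - 1 - j + 1)) b = v i := by rw [← hW.2 i, hi]; simp [prefixSum]
    have h3 := prefixSum_succ (W (c - 1 - j + 1)) (b - 1)
    rw [Nat.sub_add_cancel hb] at h3
    rw [turnGain, Nat.sub_add_cancel hb]
    omega

theorem ncard_gainMatrices_eq (hkc : k ≤ c) (hij : (j : ℕ) = i + 1) {r : ℕ}
    (hv : Transfer i j r v v') {s : ℕ} (hs : v' j + r ≤ s + v' i) :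
    (gainMatrices a b c (c - 1 - j) (s + r : ℕ) v).ncard =
      (gainMatrices a b c (c - 1 - j) s v').ncard := by
  have hne : i ≠ j := by rintro rfl; omega
  induction r generalizing v s with
  | zero =>
    have : v = v' := by
      funext l
      by_cases hli : l = i
      · subst hli; simpa using hv.to_eq.symm
      by_cases hlj : l = j
      · subst hlj; simpa using hv.from_eq
      · exact (hv.ne l hli hlj).symm
    simp [this]
  | succ r ih =>
    obtain ⟨h1, h2, h3⟩ := hv
    -- The row sums after the first of the `r + 1` moves. The bound `hs` is what the inverse of this
    -- first move requires; the later moves require less.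
    let w : Fin k → ℕ := Function.update (Function.update v j (v j - 1)) i (v i + 1)
    have hwi : w i = v i + 1 := by simp [w]
    have hwj : w j = v j - 1 := by simp [w, hne.symm]
    have hwl : ∀ l, l ≠ i → l ≠ j → w l = v l := fun l hi hj => by simp [w, hi, hj]
    have hvw : Transfer i j 1 v w := ⟨by omega, by omega, hwl⟩
    have hwv : Transfer i j r w v' :=
      ⟨by omega, by omega, fun l hi hj => (h3 l hi hj).trans (hwl l hi hj).symm⟩
    rw [← ih hwv (by omega)]
    have : ((s + (r + 1) : ℕ) : ℤ) = ((s + r : ℕ) : ℤ) + 1 := by push_cast; ring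
    rw [this]
    exact le_antisymm (ncard_gainMatrices_le hkc hij hvw (by omega))
      (ncard_gainMatrices_ge hkc hij hvw (by omega))

theorem ncard_rowSumMatrices_comp_swap (hb : 0 < b) (hkc : k ≤ c) (hij : (j : ℕ) = i + 1)
    (v : Fin k → ℕ) :
    (rowSumMatrices a b c (v ∘ Equiv.swap i j)).ncard = (rowSumMatrices a b c v).ncard := by
  have hne : i ≠ j := by rintro rfl; omega
  have key : ∀ v : Fin k → ℕ, v i ≤ v j →
      (rowSumMatrices a b c (v ∘ Equiv.swap i j)).ncard = (rowSumMatrices a b c v).ncard := by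
    intro v h
    obtain ⟨r, hr⟩ := Nat.exists_eq_add_of_le h
    have hT : Transfer i j r v (v ∘ Equiv.swap i j) :=
      ⟨by simpa using hr, by simpa using hr,
        fun l hi hj => by simp [Equiv.swap_apply_of_ne_of_ne hi hj]⟩
    -- With `r` the difference of the two entries, the thresholds `r` for `v` and `0` for the
    -- swapped vector are both vacuous, so `r` moves give a bijection between the full sets.
    have := ncard_gainMatrices_eq (a := a) (b := b) hkc hij hT (s := 0) (by simp; omega)
    rw [gainMatrices_eq hb hkc hij (by right; push_cast; omega),
      gainMatrices_eq hb hkc hij (by left; simp)] at this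
    exact this.symm
  rcases le_total (v i) (v j) with h | h
  · exact key v h
  · have := key (v ∘ Equiv.swap i j) (by simpa using h)
    rw [← this]
    congr 2
    funext l
    simp

/-- Since `v i < v j`, every matrix has a gain of at least one, so a single move is defined
everywhere. -/
theorem ncard_rowSumMatrices_le_of_adjacent (hb : 0 < b) (hkc : k ≤ c) (hij : (j : ℕ) = i + 1)
    (hv : Transfer i j 1 v v') (h : v i < v j) :
    (rowSumMatrices a b c v).ncard ≤ (rowSumMatrices a b c v').ncard := by
  have := ncard_gainMatrices_le (a := a) (b := b) hkc hij hv (s := 0) le_rfl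
  rwa [gainMatrices_eq hb hkc hij (by right; omega), gainMatrices_eq hb hkc hij (by left; rfl)]
    at this

end Adjacent

/-! ### Symmetry of the count and the dominance order -/

theorem ncard_rowSumMatrices_comp_perm {a b c k : ℕ} (hb : 0 < b) (hkc : k ≤ c) (v : Fin k → ℕ)
    (π : Equiv.Perm (Fin k)) :
    (rowSumMatrices a b c (v ∘ π)).ncard = (rowSumMatrices a b c v).ncard := by
  rcases k with _ | n
  · rw [Subsingleton.elim (v ∘ π) v]
  have hπ : π ∈ Submonoid.closure
      (Set.range fun i : Fin n => Equiv.swap i.castSucc i.succ) := by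
    rw [Equiv.Perm.mclosure_swap_castSucc_succ]
    trivial
  induction hπ using Submonoid.closure_induction generalizing v with
  | mem π h =>
    obtain ⟨i, rfl⟩ := h
    exact ncard_rowSumMatrices_comp_swap hb hkc (by simp) v
  | one => rfl
  | mul π ρ _ _ h1 h2 =>
    rw [Equiv.Perm.coe_mul, ← Function.comp_assoc, h2, h1]

theorem ncard_rowSumMatrices_le_of_transfer {a b c k : ℕ} (hb : 0 < b) (hkc : k ≤ c)
    {v v' : Fin k → ℕ} {i j : Fin k} (hv : Transfer i j 1 v v') (h : v i < v j) :
    (rowSumMatrices a b c v).ncard ≤ (rowSumMatrices a b c v').ncard := by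
  have hij : i ≠ j := by rintro rfl; omega
  have hk : 1 < k := by
    by_contra hk
    exact hij (Fin.ext (by omega))
  let i₀ : Fin k := ⟨0, by omega⟩
  let j₀ : Fin k := ⟨1, hk⟩
  have hne₀ : i₀ ≠ j₀ := by simp [i₀, j₀]
  -- By symmetry the two entries may be brought to the adjacent positions `0` and `1`.
  obtain ⟨π, hi, hj⟩ : ∃ π : Equiv.Perm (Fin k), π i₀ = i ∧ π j₀ = j := by
    refine ⟨Equiv.swap (Equiv.swap i₀ i j₀) j * Equiv.swap i₀ i, ?_, ?_⟩
    · rw [Equiv.Perm.mul_apply, Equiv.swap_apply_left]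
      refine Equiv.swap_apply_of_ne_of_ne ?_ hij
      intro hi
      exact hne₀ ((Equiv.swap i₀ i).injective (by rw [Equiv.swap_apply_left, ← hi]))
    · rw [Equiv.Perm.mul_apply, Equiv.swap_apply_left]
  rw [← ncard_rowSumMatrices_comp_perm hb hkc v π, ← ncard_rowSumMatrices_comp_perm hb hkc v' π]
  refine ncard_rowSumMatrices_le_of_adjacent (i := i₀) (j := j₀) hb hkc rfl
    ⟨?_, ?_, fun l hli hlj => ?_⟩ ?_
  · simpa [hj] using hv.from_eq
  · simpa [hi] using hv.to_eq
  · exact hv.ne _ (fun h => hli (π.injective (h.trans hi.symm)))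
      (fun h => hlj (π.injective (h.trans hj.symm)))
  · simpa [hi, hj] using h

theorem Transfer.sum_eq {k : ℕ} {v v' : Fin k → ℕ} {i j : Fin k} (h : Transfer i j 1 v v')
    (hij : i ≠ j) (s : Finset (Fin k)) :
    ∑ l ∈ s, v' l + (if j ∈ s then 1 else 0) = ∑ l ∈ s, v l + if i ∈ s then 1 else 0 := by
  have hpt : ∀ l, v' l + (if l = j then 1 else 0) = v l + if l = i then 1 else 0 := by
    intro l
    have h1 := h.from_eq
    have h2 := h.to_eq
    by_cases hi : l = i
    · subst hi; simp [hij, h2]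
    by_cases hj : l = j
    · subst hj; simp [hi, h1]
    simp [hi, hj, h.ne l hi hj]
  have := Finset.sum_congr (rfl : s = s) fun l _ => hpt l
  simpa [Finset.sum_add_distrib] using this

/-- A function that does not decrease when a unit is moved from a larger to a smaller entry is
reversed by domination over weakly decreasing vectors. -/
theorem Dominates.le_of_transfer {k : ℕ} {F : (Fin k → ℕ) → ℕ}
    (hF : ∀ v v' i j, Transfer i j 1 v v' → v i < v j → F v ≤ F v') {α β : Fin k → ℕ}
    (hα : Antitone α) (h : Dominates β α) : F β ≤ F α := by
  by_cases hne : ∀ l, α l ≤ β l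
  · have : β = α := by
      funext l
      by_contra hl
      have := Finset.sum_lt_sum (fun l (_ : l ∈ Finset.univ) => hne l)
        ⟨l, Finset.mem_univ l, lt_of_le_of_ne (hne l) (Ne.symm hl)⟩
      exact this.ne h.2
    rw [this]
  push Not at hne
  obtain ⟨j, hj, hmin⟩ : ∃ j, β j < α j ∧ ∀ l < j, α l ≤ β l := by
    obtain ⟨j, hj, hmin⟩ := WellFounded.has_min (wellFounded_lt (α := Fin k))
      {j | β j < α j} hne
    exact ⟨j, hj, fun l hl => not_lt.1 fun h => hmin l h hl⟩
  -- Otherwise the partial sum of `β` up to `j` would be too small. Now `β j < α j ≤ α i < β i`,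
  -- where the middle step is the only use of monotonicity of `α`; `β` need not be monotone.
  obtain ⟨i, hij, hi⟩ : ∃ i < j, α i < β i := by
    by_contra! hcon
    refine (h.1 j).not_gt (Finset.sum_lt_sum (fun l hl => ?_) ⟨j, by simp, hj⟩)
    rcases (Finset.mem_Iic.1 hl).lt_or_eq with hl | rfl
    · exact hcon l hl
    · exact hj.le
  have hαij := hα hij.le
  let β' : Fin k → ℕ := Function.update (Function.update β i (β i - 1)) j (β j + 1)
  have hβ'i : β' i = β i - 1 := by simp [β', hij.ne]
  have hβ'j : β' j = β j + 1 := by simp [β']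
  have hβ'l : ∀ l, l ≠ j → l ≠ i → β' l = β l := fun l h1 h2 => by simp [β', h1, h2]
  have hT : Transfer j i 1 β β' := ⟨by omega, hβ'j, hβ'l⟩
  have hdom : Dominates β' α := by
    refine ⟨fun l => ?_, ?_⟩
    · have h1 := hT.sum_eq hij.ne' (Finset.Iic l)
      have h2 := h.1 l
      simp only [Finset.mem_Iic] at h1
      by_cases hjl : j ≤ l
      · rw [if_pos hjl, if_pos (hij.le.trans hjl)] at h1
        omega
      by_cases hil : i ≤ l
      · rw [if_neg hjl, if_pos hil] at h1
        -- Only partial sums with `i ≤ l < j` lose a unit. There the domination is strict, since `β`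
        -- is at least `α` before `j` and larger at `i`.
        have : ∑ m ∈ Finset.Iic l, α m < ∑ m ∈ Finset.Iic l, β m :=
          Finset.sum_lt_sum
            (fun m hm => hmin m ((Finset.mem_Iic.1 hm).trans_lt (not_le.1 hjl)))
            ⟨i, by simpa using hil, hi⟩
        omega
      · rw [if_neg hjl, if_neg hil] at h1
        omega
    · have h1 := hT.sum_eq hij.ne' Finset.univ
      have h2 := h.2
      simp only [Finset.mem_univ, if_true] at h1
      omega
  have hlt : ∑ l, (β' l - α l) < ∑ l, (β l - α l) := by
    refine Finset.sum_lt_sum (fun l _ => ?_) ⟨i, Finset.mem_univ i, by omega⟩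
    by_cases h1 : l = j
    · subst h1; omega
    by_cases h2 : l = i
    · subst h2; omega
    rw [hβ'l l h1 h2]
  exact (hF β β' j i hT (by omega)).trans (Dominates.le_of_transfer hF hα hdom)
termination_by ∑ l, (β l - α l)

theorem ncard_rowSumMatrices_le_of_dominates {a b c k : ℕ} (hb : 0 < b) (hkc : k ≤ c)
    {α β : Fin k → ℕ} {σ τ : Equiv.Perm (Fin k)} (hα : Antitone (α ∘ σ))
    (hdom : Dominates (β ∘ τ) (α ∘ σ)) :
    (rowSumMatrices a b c β).ncard ≤ (rowSumMatrices a b c α).ncard := by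
  rw [← ncard_rowSumMatrices_comp_perm hb hkc β τ, ← ncard_rowSumMatrices_comp_perm hb hkc α σ]
  exact hdom.le_of_transfer (F := fun v => (rowSumMatrices a b c v).ncard)
    (fun v v' i j hT h => ncard_rowSumMatrices_le_of_transfer hb hkc hT h) hα

/-! ## Height functions of tilings -/

theorem mem_hexagon {a b c : ℕ} {u v : ℤ} : (u, v) ∈ hexagon a b c ↔
    -(c : ℤ) ≤ u ∧ u ≤ b ∧ -(c : ℤ) ≤ v ∧ v ≤ a ∧ -(a : ℤ) ≤ u - v ∧ u - v ≤ b :=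
  Iff.rfl

theorem lower_mem_hexagonTriangles {a b c : ℕ} {u v : ℤ} :
    Triangle.lower u v ∈ hexagonTriangles a b c ↔ (u, v) ∈ hexagon a b c ∧
      (u + 1, v) ∈ hexagon a b c ∧ (u + 1, v + 1) ∈ hexagon a b c := by
  simp [hexagonTriangles, Triangle.vertices, Set.insert_subset_iff]

theorem upper_mem_hexagonTriangles {a b c : ℕ} {u v : ℤ} :
    Triangle.upper u v ∈ hexagonTriangles a b c ↔ (u, v) ∈ hexagon a b c ∧
      (u, v + 1) ∈ hexagon a b c ∧ (u + 1, v + 1) ∈ hexagon a b c := by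
  simp [hexagonTriangles, Triangle.vertices, Set.insert_subset_iff]

open Classical in
/-- `1` if the lozenge `L` belongs to `T`, and `0` otherwise. -/
noncomputable def lozengeCount (T : Finset Lozenge) (L : Lozenge) : ℕ := if L ∈ T then 1 else 0

theorem lozengeCount_of_mem {T : Finset Lozenge} {L : Lozenge} (h : L ∈ T) :
    lozengeCount T L = 1 := if_pos h

theorem lozengeCount_of_not_mem {T : Finset Lozenge} {L : Lozenge} (h : L ∉ T) :
    lozengeCount T L = 0 := if_neg h

theorem mem_iff_lozengeCount {T : Finset Lozenge} {L : Lozenge} :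
    L ∈ T ↔ lozengeCount T L = 1 := by
  unfold lozengeCount; split_ifs with h <;> simp [h]

theorem lozengeCount_le_one (T : Finset Lozenge) (L : Lozenge) : lozengeCount T L ≤ 1 := by
  unfold lozengeCount; split_ifs <;> omega

/-- The height of the surface at the point that is drawn at the vertex `(u, v)`. -/
noncomputable def vertexHeight (a b c : ℕ) (T : Finset Lozenge) (u v : ℤ) : ℕ :=
  topHeight a b c T (u - 1) (v - 1)

theorem topHeight_eq_vertexHeight (a b c : ℕ) (T : Finset Lozenge) (u v : ℤ) :
    topHeight a b c T u v = vertexHeight a b c T (u + 1) (v + 1) := by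
  simp [vertexHeight]

theorem vertexHeight_eq_zero {a b c : ℕ} (T : Finset Lozenge) {u v : ℤ}
    (h' : u = b ∨ v = a) : vertexHeight a b c T u v = 0 := by
  unfold vertexHeight topHeight
  convert Set.ncard_empty ℤ
  refine Set.eq_empty_iff_forall_notMem.2 ?_
  rintro s ⟨h1, -, h3, -⟩
  rw [mem_hexagon] at h3
  omega

/-- One step down the picture: the counted segments below `(u, v)` are those below `(u + 1, v + 1)`,
shifted by one, and possibly the segment between the two. -/
theorem vertexHeight_add_lozengeCount {a b c : ℕ} (T : Finset Lozenge) {u v : ℤ}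
    (h : (u, v) ∈ hexagon a b c) (h' : (u + 1, v + 1) ∈ hexagon a b c) :
    vertexHeight a b c T u v + lozengeCount T (.top u v) =
      vertexHeight a b c T (u + 1) (v + 1) + 1 := by
  unfold vertexHeight topHeight
  simp only [add_sub_cancel_right]
  set S : Set ℤ := {s : ℤ | 1 ≤ s ∧ (u + s, v + s) ∈ hexagon a b c ∧
    (u + s + 1, v + s + 1) ∈ hexagon a b c ∧ Lozenge.top (u + s) (v + s) ∉ T} with hS
  have hfin : S.Finite := by
    refine (Set.finite_Icc (1 : ℤ) (b - u)).subset ?_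
    rintro s ⟨h1, h2, -⟩
    rw [mem_hexagon] at h2
    exact ⟨h1, by omega⟩
  have himg : ((fun s : ℤ => s + 1) '' S).ncard = S.ncard :=
    Set.ncard_image_of_injective _ (add_left_injective 1)
  have hmem : ∀ s : ℤ, s ∈ (fun s : ℤ => s + 1) '' S ↔ 2 ≤ s ∧
      (u - 1 + s, v - 1 + s) ∈ hexagon a b c ∧ (u - 1 + s + 1, v - 1 + s + 1) ∈ hexagon a b c ∧
        Lozenge.top (u - 1 + s) (v - 1 + s) ∉ T := by
    intro s
    constructor
    · rintro ⟨s, ⟨h1, h2, h3, h4⟩, rfl⟩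
      have e1 : u - 1 + (s + 1) = u + s := by ring
      have e2 : v - 1 + (s + 1) = v + s := by ring
      simp only [e1, e2]
      exact ⟨by omega, h2, h3, h4⟩
    · rintro ⟨h1, h2, h3, h4⟩
      refine ⟨s - 1, ⟨by omega, ?_⟩, by simp⟩
      have e1 : u + (s - 1) = u - 1 + s := by ring
      have e2 : v + (s - 1) = v - 1 + s := by ring
      simp only [e1, e2]
      exact ⟨h2, h3, h4⟩
  by_cases ht : Lozenge.top u v ∈ T
  · rw [lozengeCount_of_mem ht, ← himg]
    congr 2
    ext s
    rw [hmem]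
    constructor
    · rintro ⟨h1, h2⟩
      refine ⟨?_, h2⟩
      by_contra hs
      obtain rfl : s = 1 := by omega
      exact h2.2.2 (by simpa using ht)
    · rintro ⟨h1, h2⟩
      exact ⟨by omega, h2⟩
  · rw [lozengeCount_of_not_mem ht, ← himg, add_zero,
      ← Set.ncard_insert_of_notMem (a := (1 : ℤ)) ?_ (hfin.image _)]
    · congr 1
      ext s
      rw [Set.mem_insert_iff, hmem]
      constructor
      · rintro ⟨h1, h2⟩
        by_cases hs : s = 1
        · exact Or.inl hs
        · exact Or.inr ⟨by omega, h2⟩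
      · rintro (rfl | ⟨h1, h2⟩)
        · exact ⟨le_rfl, by simpa using h, by simpa using h', by simpa using ht⟩
        · exact ⟨by omega, h2⟩
    · rw [hmem]
      omega

namespace IsLozengeTiling

variable {a b c : ℕ} {T : Finset Lozenge} {u v : ℤ}

theorem top_mem_hexagon (hT : IsLozengeTiling a b c T) (h : Lozenge.top u v ∈ T) :
    (u, v) ∈ hexagon a b c ∧ (u + 1, v) ∈ hexagon a b c ∧ (u, v + 1) ∈ hexagon a b c ∧
      (u + 1, v + 1) ∈ hexagon a b c := by
  have h1 := lower_mem_hexagonTriangles.1 (hT.1 _ h (show Triangle.lower u v ∈ _ from Or.inl rfl))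
  have h2 := upper_mem_hexagonTriangles.1 (hT.1 _ h (show Triangle.upper u v ∈ _ from Or.inr rfl))
  exact ⟨h1.1, h1.2.1, h2.2.1, h1.2.2⟩

theorem left_mem_hexagon (hT : IsLozengeTiling a b c T) (h : Lozenge.left u v ∈ T) :
    (u, v) ∈ hexagon a b c ∧ (u, v + 1) ∈ hexagon a b c ∧ (u + 1, v + 1) ∈ hexagon a b c ∧
      (u + 1, v + 2) ∈ hexagon a b c := by
  have h1 := upper_mem_hexagonTriangles.1 (hT.1 _ h (show Triangle.upper u v ∈ _ from Or.inl rfl))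
  have h2 := lower_mem_hexagonTriangles.1
    (hT.1 _ h (show Triangle.lower u (v + 1) ∈ _ from Or.inr rfl))
  refine ⟨h1.1, h1.2.1, h1.2.2, ?_⟩
  have := h2.2.2
  rwa [show v + 1 + 1 = v + 2 by ring] at this

theorem right_mem_hexagon (hT : IsLozengeTiling a b c T) (h : Lozenge.right u v ∈ T) :
    (u, v) ∈ hexagon a b c ∧ (u + 1, v) ∈ hexagon a b c ∧ (u + 1, v + 1) ∈ hexagon a b c ∧
      (u + 2, v + 1) ∈ hexagon a b c := by
  have h1 := lower_mem_hexagonTriangles.1 (hT.1 _ h (show Triangle.lower u v ∈ _ from Or.inl rfl))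
  have h2 := upper_mem_hexagonTriangles.1
    (hT.1 _ h (show Triangle.upper (u + 1) v ∈ _ from Or.inr rfl))
  refine ⟨h1.1, h1.2.1, h1.2.2, ?_⟩
  have := h2.2.2
  rwa [show u + 1 + 1 = u + 2 by ring] at this

theorem lower_count (hT : IsLozengeTiling a b c T) (h1 : (u, v) ∈ hexagon a b c)
    (h2 : (u + 1, v) ∈ hexagon a b c) (h3 : (u + 1, v + 1) ∈ hexagon a b c) :
    lozengeCount T (.top u v) + lozengeCount T (.left u (v - 1)) +
      lozengeCount T (.right u v) = 1 := by
  obtain ⟨L, ⟨hL, hL'⟩, huniq⟩ := hT.2 _ (lower_mem_hexagonTriangles.2 ⟨h1, h2, h3⟩)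
  have hc : ∀ L', Triangle.lower u v ∈ L'.triangles → L' ≠ L → lozengeCount T L' = 0 :=
    fun L' h hne => lozengeCount_of_not_mem fun hmem => hne (huniq L' ⟨hmem, h⟩)
  have ht : Triangle.lower u v ∈ (Lozenge.top u v).triangles := by simp [Lozenge.triangles]
  have hl : Triangle.lower u v ∈ (Lozenge.left u (v - 1)).triangles := by simp [Lozenge.triangles]
  have hr : Triangle.lower u v ∈ (Lozenge.right u v).triangles := by simp [Lozenge.triangles]
  rcases L with ⟨u', v'⟩ | ⟨u', v'⟩ | ⟨u', v'⟩ <;> simp [Lozenge.triangles] at hL'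
  · obtain ⟨rfl, rfl⟩ := hL'
    rw [lozengeCount_of_mem hL, hc _ hl (by simp), hc _ hr (by simp)]
  · obtain ⟨rfl, rfl⟩ := hL'
    rw [show v' + 1 - 1 = v' by ring] at *
    rw [lozengeCount_of_mem hL, hc _ ht (by simp), hc _ hr (by simp)]
  · obtain ⟨rfl, rfl⟩ := hL'
    rw [lozengeCount_of_mem hL, hc _ ht (by simp), hc _ hl (by simp)]

theorem upper_count (hT : IsLozengeTiling a b c T) (h1 : (u, v) ∈ hexagon a b c)
    (h2 : (u, v + 1) ∈ hexagon a b c) (h3 : (u + 1, v + 1) ∈ hexagon a b c) :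
    lozengeCount T (.top u v) + lozengeCount T (.left u v) +
      lozengeCount T (.right (u - 1) v) = 1 := by
  obtain ⟨L, ⟨hL, hL'⟩, huniq⟩ := hT.2 _ (upper_mem_hexagonTriangles.2 ⟨h1, h2, h3⟩)
  have hc : ∀ L', Triangle.upper u v ∈ L'.triangles → L' ≠ L → lozengeCount T L' = 0 :=
    fun L' h hne => lozengeCount_of_not_mem fun hmem => hne (huniq L' ⟨hmem, h⟩)
  have ht : Triangle.upper u v ∈ (Lozenge.top u v).triangles := by simp [Lozenge.triangles]
  have hl : Triangle.upper u v ∈ (Lozenge.left u v).triangles := by simp [Lozenge.triangles]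
  have hr : Triangle.upper u v ∈ (Lozenge.right (u - 1) v).triangles := by
    simp [Lozenge.triangles]
  rcases L with ⟨u', v'⟩ | ⟨u', v'⟩ | ⟨u', v'⟩ <;> simp [Lozenge.triangles] at hL'
  · obtain ⟨rfl, rfl⟩ := hL'
    rw [lozengeCount_of_mem hL, hc _ hl (by simp), hc _ hr (by simp)]
  · obtain ⟨rfl, rfl⟩ := hL'
    rw [lozengeCount_of_mem hL, hc _ ht (by simp), hc _ hr (by simp)]
  · obtain ⟨rfl, rfl⟩ := hL'
    rw [show u' + 1 - 1 = u' by ring] at *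
    rw [lozengeCount_of_mem hL, hc _ ht (by simp), hc _ hl (by simp)]

theorem count_top_eq_zero (hT : IsLozengeTiling a b c T)
    (h : (u + 1, v) ∉ hexagon a b c ∨ (u, v + 1) ∉ hexagon a b c) :
    lozengeCount T (.top u v) = 0 :=
  lozengeCount_of_not_mem fun hmem => by
    have := hT.top_mem_hexagon hmem
    tauto

theorem count_left_eq_zero (hT : IsLozengeTiling a b c T)
    (h : (u, v) ∉ hexagon a b c ∨ (u + 1, v + 2) ∉ hexagon a b c) :
    lozengeCount T (.left u v) = 0 :=
  lozengeCount_of_not_mem fun hmem => by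
    have := hT.left_mem_hexagon hmem
    tauto

theorem count_right_eq_zero (hT : IsLozengeTiling a b c T)
    (h : (u, v) ∉ hexagon a b c ∨ (u + 2, v + 1) ∉ hexagon a b c) :
    lozengeCount T (.right u v) = 0 :=
  lozengeCount_of_not_mem fun hmem => by
    have := hT.right_mem_hexagon hmem
    tauto

/-- Heights are defined along diagonals, so consistency along the other edges has to be proved, by
induction from the boundary. Two adjacent diagonals enclose a lower and an upper triangle; each is
covered once, and the right tile common to both cancels. -/
theorem vertexHeight_eq_add_left (hT : IsLozengeTiling a b c T) (h1 : (u, v) ∈ hexagon a b c)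
    (h2 : (u + 1, v) ∈ hexagon a b c) :
    vertexHeight a b c T u v =
      vertexHeight a b c T (u + 1) v + lozengeCount T (.left u (v - 1)) := by
  obtain ⟨n, hn⟩ : ∃ n : ℕ, v = a - n := ⟨(a - v).toNat, by rw [mem_hexagon] at h1; omega⟩
  induction n generalizing u v with
  | zero =>
    have hv : v = a := by simpa using hn
    rw [vertexHeight_eq_zero T (Or.inr hv), vertexHeight_eq_zero T (Or.inr hv),
      hT.count_left_eq_zero]
    right
    rw [mem_hexagon]
    omega
  | succ n ih =>
    have h3 : (u + 1, v + 1) ∈ hexagon a b c := by rw [mem_hexagon] at *; omega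
    have d1 := vertexHeight_add_lozengeCount T h1 h3
    have l1 := hT.lower_count h1 h2 h3
    rcases eq_or_ne (u + 1) b with hu | hu
    · rw [vertexHeight_eq_zero T (Or.inl hu)] at d1 ⊢
      have := hT.count_right_eq_zero (u := u) (v := v) (by right; rw [mem_hexagon]; omega)
      omega
    · have h4 : (u + 1 + 1, v + 1) ∈ hexagon a b c := by rw [mem_hexagon] at *; omega
      have d2 := vertexHeight_add_lozengeCount T h2 h4
      have l2 := hT.upper_count h2 h3 h4
      have := ih h3 h4 (by omega)
      simp only [add_sub_cancel_right] at this l2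
      omega

theorem vertexHeight_eq_add_right (hT : IsLozengeTiling a b c T) (h1 : (u, v) ∈ hexagon a b c)
    (h2 : (u, v + 1) ∈ hexagon a b c) :
    vertexHeight a b c T u v =
      vertexHeight a b c T u (v + 1) + lozengeCount T (.right (u - 1) v) := by
  obtain ⟨n, hn⟩ : ∃ n : ℕ, u = b - n := ⟨(b - u).toNat, by rw [mem_hexagon] at h1; omega⟩
  induction n generalizing u v with
  | zero =>
    have hu : u = b := by simpa using hn
    rw [vertexHeight_eq_zero T (Or.inl hu), vertexHeight_eq_zero T (Or.inl hu),
      hT.count_right_eq_zero]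
    right
    rw [mem_hexagon]
    omega
  | succ n ih =>
    have h3 : (u + 1, v + 1) ∈ hexagon a b c := by rw [mem_hexagon] at *; omega
    have d1 := vertexHeight_add_lozengeCount T h1 h3
    have l1 := hT.upper_count h1 h2 h3
    rcases eq_or_ne (v + 1) a with hv | hv
    · rw [vertexHeight_eq_zero T (Or.inr hv)] at d1 ⊢
      have := hT.count_left_eq_zero (u := u) (v := v) (by right; rw [mem_hexagon]; omega)
      omega
    · have h4 : (u + 1, v + 1 + 1) ∈ hexagon a b c := by rw [mem_hexagon] at *; omega
      have d2 := vertexHeight_add_lozengeCount T h2 h4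
      have l2 := hT.lower_count h2 h3 h4
      have := ih h3 h4 (by omega)
      simp only [add_sub_cancel_right] at this l2
      omega

theorem _root_.vertexHeight_le_sub (h : (u, v) ∈ hexagon a b c) :
    (vertexHeight a b c T u v : ℤ) ≤ b - u ∧ (vertexHeight a b c T u v : ℤ) ≤ a - v := by
  obtain ⟨n, hn⟩ : ∃ n : ℕ, u = b - n := ⟨(b - u).toNat, by rw [mem_hexagon] at h; omega⟩
  induction n generalizing u v with
  | zero =>
    rw [vertexHeight_eq_zero T (Or.inl (by omega))]
    rw [mem_hexagon] at h
    omega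
  | succ n ih =>
    rcases eq_or_ne v a with hv | hv
    · rw [vertexHeight_eq_zero T (Or.inr hv)]
      omega
    · have h' : (u + 1, v + 1) ∈ hexagon a b c := by rw [mem_hexagon] at *; omega
      have := vertexHeight_add_lozengeCount T h h'
      have := ih h' (by omega)
      omega

theorem vertexHeight_of_sub_eq (hT : IsLozengeTiling a b c T) (h : (u, v) ∈ hexagon a b c)
    (huv : u - v = b) : (vertexHeight a b c T u v : ℤ) = -v := by
  obtain ⟨n, hn⟩ : ∃ n : ℕ, v = -n := ⟨(-v).toNat, by rw [mem_hexagon] at h; omega⟩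
  induction n generalizing u v with
  | zero =>
    rw [vertexHeight_eq_zero T (Or.inl (by omega))]
    omega
  | succ n ih =>
    have h' : (u + 1, v + 1) ∈ hexagon a b c := by rw [mem_hexagon] at *; omega
    have h1 := vertexHeight_add_lozengeCount T h h'
    have h2 := ih h' (by omega) (by omega)
    rw [hT.count_top_eq_zero (by left; rw [mem_hexagon]; omega)] at h1
    omega

theorem vertexHeight_of_sub_eq_neg (hT : IsLozengeTiling a b c T) (h : (u, v) ∈ hexagon a b c)
    (huv : u - v = -a) : (vertexHeight a b c T u v : ℤ) = -u := by
  obtain ⟨n, hn⟩ : ∃ n : ℕ, u = -n := ⟨(-u).toNat, by rw [mem_hexagon] at h; omega⟩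
  induction n generalizing u v with
  | zero =>
    rw [vertexHeight_eq_zero T (Or.inr (by omega))]
    omega
  | succ n ih =>
    have h' : (u + 1, v + 1) ∈ hexagon a b c := by rw [mem_hexagon] at *; omega
    have h1 := vertexHeight_add_lozengeCount T h h'
    have h2 := ih h' (by omega) (by omega)
    rw [hT.count_top_eq_zero (by right; rw [mem_hexagon]; omega)] at h1
    omega

theorem vertexHeight_of_eq_neg (hT : IsLozengeTiling a b c T) (h : (u, v) ∈ hexagon a b c)
    (hv : v = -c) : vertexHeight a b c T u v = c := by
  obtain ⟨n, hn⟩ : ∃ n : ℕ, u = b - c - n :=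
    ⟨(b - c - u).toNat, by rw [mem_hexagon] at h; omega⟩
  induction n generalizing u with
  | zero =>
    have := hT.vertexHeight_of_sub_eq h (by omega)
    omega
  | succ n ih =>
    have h' : (u + 1, v) ∈ hexagon a b c := by rw [mem_hexagon] at *; omega
    rw [hT.vertexHeight_eq_add_left h h', ih h' (by omega),
      hT.count_left_eq_zero (by left; rw [mem_hexagon]; omega)]
    rfl

theorem vertexHeight_le (hT : IsLozengeTiling a b c T) (h : (u, v) ∈ hexagon a b c) :
    vertexHeight a b c T u v ≤ c := by
  obtain ⟨n, hn⟩ : ∃ n : ℕ, v = n - c := ⟨(v + c).toNat, by rw [mem_hexagon] at h; omega⟩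
  induction n generalizing v with
  | zero => exact (hT.vertexHeight_of_eq_neg h (by omega)).le
  | succ n ih =>
    rcases eq_or_ne (u - v) b with huv | huv
    · have := hT.vertexHeight_of_sub_eq h huv
      omega
    · have h' : (u, v - 1) ∈ hexagon a b c := by rw [mem_hexagon] at *; omega
      have h1 := ih h' (by omega)
      have h2 := hT.vertexHeight_eq_add_right h' (by simpa using h)
      simp only [sub_add_cancel] at h2
      omega

theorem neg_right_le_vertexHeight (hT : IsLozengeTiling a b c T) (h : (u, v) ∈ hexagon a b c) :
    -v ≤ (vertexHeight a b c T u v : ℤ) := by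
  obtain ⟨n, hn⟩ : ∃ n : ℕ, u - v = b - n := ⟨(b - (u - v)).toNat, by rw [mem_hexagon] at h; omega⟩
  induction n generalizing u with
  | zero => exact (hT.vertexHeight_of_sub_eq h (by omega)).ge
  | succ n ih =>
    rcases eq_or_ne u b with hu | hu
    · omega
    · have h' : (u + 1, v) ∈ hexagon a b c := by rw [mem_hexagon] at *; omega
      have h1 := ih h' (by omega)
      have h2 := hT.vertexHeight_eq_add_left h h'
      omega

theorem neg_left_le_vertexHeight (hT : IsLozengeTiling a b c T) (h : (u, v) ∈ hexagon a b c) :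
    -u ≤ (vertexHeight a b c T u v : ℤ) := by
  obtain ⟨n, hn⟩ : ∃ n : ℕ, u - v = n - a := ⟨(u - v + a).toNat, by rw [mem_hexagon] at h; omega⟩
  induction n generalizing v with
  | zero => exact (hT.vertexHeight_of_sub_eq_neg h (by omega)).ge
  | succ n ih =>
    rcases eq_or_ne v a with hv | hv
    · omega
    · have h' : (u, v + 1) ∈ hexagon a b c := by rw [mem_hexagon] at *; omega
      have h1 := ih h' (by omega)
      have h2 := hT.vertexHeight_eq_add_right h h'
      omega

end IsLozengeTiling

/-! ### Height functions determine tilings -/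

/-- The height functions of the tilings of the hexagon. -/
structure IsHeightFunction (a b c : ℕ) (H : ℤ → ℤ → ℕ) : Prop where
  x_le : ∀ {u v}, (u, v) ∈ hexagon a b c → (u + 1, v) ∈ hexagon a b c → H (u + 1) v ≤ H u v
  y_le : ∀ {u v}, (u, v) ∈ hexagon a b c → (u, v + 1) ∈ hexagon a b c → H u (v + 1) ≤ H u v
  diag_le : ∀ {u v}, (u, v) ∈ hexagon a b c → (u + 1, v + 1) ∈ hexagon a b c →
    H u v ≤ H (u + 1) (v + 1) + 1
  le_c : ∀ {u v}, (u, v) ∈ hexagon a b c → H u v ≤ c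
  le_b : ∀ {u v}, (u, v) ∈ hexagon a b c → (H u v : ℤ) ≤ b - u
  le_a : ∀ {u v}, (u, v) ∈ hexagon a b c → (H u v : ℤ) ≤ a - v
  ge_u : ∀ {u v}, (u, v) ∈ hexagon a b c → -u ≤ (H u v : ℤ)
  ge_v : ∀ {u v}, (u, v) ∈ hexagon a b c → -v ≤ (H u v : ℤ)

/-- The point at height `z` drawn at `(u, v)` has `x = u + z` and `y = v + z`, so the last five
conditions keep the surface inside the box. -/
theorem IsLozengeTiling.isHeightFunction {a b c : ℕ} {T : Finset Lozenge}
    (hT : IsLozengeTiling a b c T) : IsHeightFunction a b c (vertexHeight a b c T) where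
  x_le h h' := by have := hT.vertexHeight_eq_add_left h h'; omega
  y_le h h' := by have := hT.vertexHeight_eq_add_right h h'; omega
  diag_le h h' := by have := vertexHeight_add_lozengeCount T h h'; omega
  le_c h := hT.vertexHeight_le h
  le_b h := (vertexHeight_le_sub h).1
  le_a h := (vertexHeight_le_sub h).2
  ge_u h := hT.neg_left_le_vertexHeight h
  ge_v h := hT.neg_right_le_vertexHeight h

/-- The lozenges that are seen on the surface with height function `H`. -/
def surfaceLozenges (a b c : ℕ) (H : ℤ → ℤ → ℕ) : Set Lozenge := {L | match L with
  | .top u v => (u, v) ∈ hexagon a b c ∧ (u + 1, v) ∈ hexagon a b c ∧ (u, v + 1) ∈ hexagon a b c ∧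
      (u + 1, v + 1) ∈ hexagon a b c ∧ H u v = H (u + 1) (v + 1)
  | .left u v => (u, v) ∈ hexagon a b c ∧ (u, v + 1) ∈ hexagon a b c ∧
      (u + 1, v + 1) ∈ hexagon a b c ∧ (u + 1, v + 2) ∈ hexagon a b c ∧
        H u (v + 1) = H (u + 1) (v + 1) + 1
  | .right u v => (u, v) ∈ hexagon a b c ∧ (u + 1, v) ∈ hexagon a b c ∧
      (u + 1, v + 1) ∈ hexagon a b c ∧ (u + 2, v + 1) ∈ hexagon a b c ∧
        H (u + 1) v = H (u + 1) (v + 1) + 1}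

theorem surfaceLozenges_finite (a b c : ℕ) (H : ℤ → ℤ → ℕ) : (surfaceLozenges a b c H).Finite := by
  have hI : (hexagon a b c).Finite := by
    refine (Set.finite_Icc ((-(c : ℤ), -(c : ℤ)) : ℤ × ℤ) ((b : ℤ), (a : ℤ))).subset ?_
    rintro ⟨u, v⟩ h
    exact ⟨⟨h.1, h.2.2.1⟩, ⟨h.2.1, h.2.2.2.1⟩⟩
  refine ((hI.image fun p : ℤ × ℤ => Lozenge.top p.1 p.2).union
    ((hI.image fun p : ℤ × ℤ => Lozenge.left p.1 p.2).union
      (hI.image fun p : ℤ × ℤ => Lozenge.right p.1 p.2))).subset ?_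
  rintro (⟨u, v⟩ | ⟨u, v⟩ | ⟨u, v⟩) h
  · exact Or.inl ⟨(u, v), h.1, rfl⟩
  · exact Or.inr (Or.inl ⟨(u, v), h.1, rfl⟩)
  · exact Or.inr (Or.inr ⟨(u, v), h.1, rfl⟩)

/-- The tiling with height function `H`. -/
noncomputable def surfaceTiling (a b c : ℕ) (H : ℤ → ℤ → ℕ) : Finset Lozenge :=
  (surfaceLozenges_finite a b c H).toFinset

theorem mem_surfaceTiling {a b c : ℕ} {H : ℤ → ℤ → ℕ} {L : Lozenge} :
    L ∈ surfaceTiling a b c H ↔ L ∈ surfaceLozenges a b c H :=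
  Set.Finite.mem_toFinset _

theorem IsLozengeTiling.eq_surfaceTiling {a b c : ℕ} {T : Finset Lozenge}
    (hT : IsLozengeTiling a b c T) : T = surfaceTiling a b c (vertexHeight a b c T) := by
  ext L
  rw [mem_surfaceTiling]
  rcases L with ⟨u, v⟩ | ⟨u, v⟩ | ⟨u, v⟩
  · constructor
    · intro h
      obtain ⟨h1, h2, h3, h4⟩ := hT.top_mem_hexagon h
      have := vertexHeight_add_lozengeCount T h1 h4
      rw [lozengeCount_of_mem h] at this
      exact ⟨h1, h2, h3, h4, by omega⟩
    · rintro ⟨h1, h2, h3, h4, h⟩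
      have := vertexHeight_add_lozengeCount T h1 h4
      exact mem_iff_lozengeCount.2 (by omega)
  · constructor
    · intro h
      obtain ⟨h1, h2, h3, h4⟩ := hT.left_mem_hexagon h
      have := hT.vertexHeight_eq_add_left h2 h3
      rw [add_sub_cancel_right, lozengeCount_of_mem h] at this
      exact ⟨h1, h2, h3, h4, this⟩
    · rintro ⟨h1, h2, h3, h4, h⟩
      have := hT.vertexHeight_eq_add_left h2 h3
      rw [add_sub_cancel_right] at this
      exact mem_iff_lozengeCount.2 (by omega)
  · constructor
    · intro h
      obtain ⟨h1, h2, h3, h4⟩ := hT.right_mem_hexagon h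
      have := hT.vertexHeight_eq_add_right h2 h3
      rw [add_sub_cancel_right, lozengeCount_of_mem h] at this
      exact ⟨h1, h2, h3, h4, this⟩
    · rintro ⟨h1, h2, h3, h4, h⟩
      have := hT.vertexHeight_eq_add_right h2 h3
      rw [add_sub_cancel_right] at this
      exact mem_iff_lozengeCount.2 (by omega)

theorem surfaceTiling_congr {a b c : ℕ} {H H' : ℤ → ℤ → ℕ}
    (h : ∀ u v, (u, v) ∈ hexagon a b c → H u v = H' u v) :
    surfaceTiling a b c H = surfaceTiling a b c H' := by
  ext L
  rw [mem_surfaceTiling, mem_surfaceTiling]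
  rcases L with ⟨u, v⟩ | ⟨u, v⟩ | ⟨u, v⟩
  · refine and_congr_right fun h1 => and_congr_right fun h2 => and_congr_right fun h3 =>
      and_congr_right fun h4 => ?_
    rw [h _ _ h1, h _ _ h4]
  · refine and_congr_right fun h1 => and_congr_right fun h2 => and_congr_right fun h3 =>
      and_congr_right fun h4 => ?_
    rw [h _ _ h2, h _ _ h3]
  · refine and_congr_right fun h1 => and_congr_right fun h2 => and_congr_right fun h3 =>
      and_congr_right fun h4 => ?_
    rw [h _ _ h2, h _ _ h3]

/-- Along the diagonal edge of a triangle the height drops by `0` or `1`. No drop means a top tile;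
a drop occurs on exactly one of the other two edges and selects a left or a right tile. The box
bounds ensure that the fourth vertex of the chosen lozenge lies in the hexagon. -/
theorem IsHeightFunction.isLozengeTiling {a b c : ℕ} {H : ℤ → ℤ → ℕ}
    (hH : IsHeightFunction a b c H) : IsLozengeTiling a b c (surfaceTiling a b c H) := by
  refine ⟨fun L hL => ?_, fun t ht => ?_⟩
  · rw [mem_surfaceTiling] at hL
    rcases L with ⟨u, v⟩ | ⟨u, v⟩ | ⟨u, v⟩ <;> obtain ⟨h1, h2, h3, h4, -⟩ := hL <;>
      simp only [Lozenge.triangles, Set.insert_subset_iff, Set.singleton_subset_iff,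
        lower_mem_hexagonTriangles, upper_mem_hexagonTriangles, add_assoc, one_add_one_eq_two]
    · exact ⟨⟨h1, h2, h4⟩, h1, h3, h4⟩
    · exact ⟨⟨h1, h2, h3⟩, h2, h3, h4⟩
    · exact ⟨⟨h1, h2, h3⟩, h2, h3, h4⟩
  · simp only [mem_surfaceTiling]
    rcases t with ⟨u, v⟩ | ⟨u, v⟩
    · rw [lower_mem_hexagonTriangles] at ht
      obtain ⟨h1, h2, h3⟩ := ht
      have b1 := hH.x_le h1 h2
      have b2 := hH.y_le h2 h3
      have b3 := hH.diag_le h1 h3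
      have c1 := hH.le_c h1
      have c2 := hH.ge_v h2
      have c3 := hH.le_b h2
      have c4 := hH.ge_u h1
      have c5 := hH.le_a h3
      have e : v - 1 + 2 = v + 1 := by ring
      have g1 := h1
      have g2 := h2
      have g3 := h3
      rw [mem_hexagon] at g1 g2 g3
      by_cases k1 : H u v = H (u + 1) (v + 1)
      · refine ⟨.top u v, ⟨⟨h1, h2, by rw [mem_hexagon]; omega, h3, k1⟩,
          by simp [Lozenge.triangles]⟩, ?_⟩
        rintro (⟨u', v'⟩ | ⟨u', v'⟩ | ⟨u', v'⟩) ⟨hm, ht⟩ <;> simp [Lozenge.triangles] at ht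
        · simp [ht]
        · obtain ⟨rfl, rfl⟩ := ht
          have := hm.2.2.2.2
          omega
        · obtain ⟨rfl, rfl⟩ := ht
          have := hm.2.2.2.2
          omega
      by_cases k2 : H u v = H (u + 1) v
      · refine ⟨.right u v, ⟨⟨h1, h2, h3, by rw [mem_hexagon]; omega, by omega⟩,
          by simp [Lozenge.triangles]⟩, ?_⟩
        rintro (⟨u', v'⟩ | ⟨u', v'⟩ | ⟨u', v'⟩) ⟨hm, ht⟩ <;> simp [Lozenge.triangles] at ht
        · obtain ⟨rfl, rfl⟩ := ht
          exact absurd hm.2.2.2.2 k1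
        · obtain ⟨rfl, rfl⟩ := ht
          have := hm.2.2.2.2
          omega
        · simp [ht]
      · refine ⟨.left u (v - 1), ⟨⟨by rw [mem_hexagon]; omega, ?_⟩,
          by simp [Lozenge.triangles]⟩, ?_⟩
        · rw [sub_add_cancel, e]
          exact ⟨h1, h2, h3, by omega⟩
        rintro (⟨u', v'⟩ | ⟨u', v'⟩ | ⟨u', v'⟩) ⟨hm, ht⟩ <;> simp [Lozenge.triangles] at ht
        · obtain ⟨rfl, rfl⟩ := ht
          exact absurd hm.2.2.2.2 k1
        · simp [ht]
        · obtain ⟨rfl, rfl⟩ := ht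
          have := hm.2.2.2.2
          omega
    · rw [upper_mem_hexagonTriangles] at ht
      obtain ⟨h1, h2, h3⟩ := ht
      have b1 := hH.y_le h1 h2
      have b2 := hH.x_le h2 h3
      have b3 := hH.diag_le h1 h3
      have c1 := hH.le_c h1
      have c2 := hH.ge_u h2
      have c3 := hH.le_a h2
      have c4 := hH.ge_v h1
      have c5 := hH.le_b h3
      have e : u - 1 + 2 = u + 1 := by ring
      have g1 := h1
      have g2 := h2
      have g3 := h3
      rw [mem_hexagon] at g1 g2 g3
      by_cases k1 : H u v = H (u + 1) (v + 1)
      · refine ⟨.top u v, ⟨⟨h1, by rw [mem_hexagon]; omega, h2, h3, k1⟩,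
          by simp [Lozenge.triangles]⟩, ?_⟩
        rintro (⟨u', v'⟩ | ⟨u', v'⟩ | ⟨u', v'⟩) ⟨hm, ht⟩ <;> simp [Lozenge.triangles] at ht
        · simp [ht]
        · obtain ⟨rfl, rfl⟩ := ht
          have := hm.2.2.2.2
          omega
        · obtain ⟨rfl, rfl⟩ := ht
          have := hm.2.2.2.2
          omega
      by_cases k2 : H u v = H u (v + 1)
      · refine ⟨.left u v, ⟨⟨h1, h2, h3, by rw [mem_hexagon]; omega, by omega⟩,
          by simp [Lozenge.triangles]⟩, ?_⟩
        rintro (⟨u', v'⟩ | ⟨u', v'⟩ | ⟨u', v'⟩) ⟨hm, ht⟩ <;> simp [Lozenge.triangles] at ht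
        · obtain ⟨rfl, rfl⟩ := ht
          exact absurd hm.2.2.2.2 k1
        · simp [ht]
        · obtain ⟨rfl, rfl⟩ := ht
          have := hm.2.2.2.2
          omega
      · refine ⟨.right (u - 1) v, ⟨⟨by rw [mem_hexagon]; omega, ?_⟩,
          by simp [Lozenge.triangles]⟩, ?_⟩
        · rw [sub_add_cancel, e]
          exact ⟨h1, h2, h3, by omega⟩
        rintro (⟨u', v'⟩ | ⟨u', v'⟩ | ⟨u', v'⟩) ⟨hm, ht⟩ <;> simp [Lozenge.triangles] at ht
        · obtain ⟨rfl, rfl⟩ := ht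
          exact absurd hm.2.2.2.2 k1
        · obtain ⟨rfl, rfl⟩ := ht
          have := hm.2.2.2.2
          omega
        · simp [ht]

theorem IsHeightFunction.vertexHeight_surfaceTiling {a b c : ℕ} {H : ℤ → ℤ → ℕ}
    (hH : IsHeightFunction a b c H) {u v : ℤ} (h : (u, v) ∈ hexagon a b c) :
    vertexHeight a b c (surfaceTiling a b c H) u v = H u v := by
  have hb := hH.le_b h
  have ha := hH.le_a h
  obtain ⟨n, hn⟩ : ∃ n : ℕ, u = b - n := ⟨(b - u).toNat, by rw [mem_hexagon] at h; omega⟩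
  induction n generalizing u v with
  | zero =>
    rw [vertexHeight_eq_zero _ (Or.inl (by omega))]
    omega
  | succ n ih =>
    rcases eq_or_ne v a with hv | hv
    · rw [vertexHeight_eq_zero _ (Or.inr hv)]
      omega
    have h' : (u + 1, v + 1) ∈ hexagon a b c := by rw [mem_hexagon] at *; omega
    have hb' := hH.le_b h'
    have ha' := hH.le_a h'
    have h1 := vertexHeight_add_lozengeCount (surfaceTiling a b c H) h h'
    rw [ih h' hb' ha' (by omega)] at h1
    have hu := hH.ge_u h
    have hv := hH.ge_v h
    have hd := hH.diag_le h h'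
    have hle := lozengeCount_le_one (surfaceTiling a b c H) (.top u v)
    by_cases ht : H u v = H (u + 1) (v + 1)
    · have : Lozenge.top u v ∈ surfaceTiling a b c H := by
        rw [mem_surfaceTiling]
        refine ⟨h, ?_, ?_, h', ht⟩ <;> rw [mem_hexagon] at * <;> omega
      rw [lozengeCount_of_mem this] at h1
      omega
    · have : Lozenge.top u v ∉ surfaceTiling a b c H := by
        rw [mem_surfaceTiling]
        exact fun hm => ht hm.2.2.2.2
      rw [lozengeCount_of_not_mem this] at h1
      have hge : H (u + 1) (v + 1) ≤ H u v := by
        by_cases hx : (u + 1, v) ∈ hexagon a b c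
        · exact (hH.y_le hx h').trans (hH.x_le h hx)
        · rw [mem_hexagon] at *
          omega
      omega

/-! ## Tilings and matrices of corners -/

theorem lt_card_filter_range_iff {p : ℕ → Prop} [DecidablePred p] {n i : ℕ} (hi : i < n)
    (hp : ∀ j k, j ≤ k → k < n → p k → p j) : i < ((Finset.range n).filter p).card ↔ p i := by
  constructor
  · intro h
    by_contra hpi
    have : (Finset.range n).filter p ⊆ Finset.range i := by
      intro j hj
      rw [Finset.mem_filter, Finset.mem_range] at hj
      rw [Finset.mem_range]
      by_contra hij
      exact hpi (hp i j (by omega) hj.1 hj.2)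
    have := Finset.card_le_card this
    rw [Finset.card_range] at this
    omega
  · intro h
    have : Finset.range (i + 1) ⊆ (Finset.range n).filter p := by
      intro j hj
      rw [Finset.mem_range] at hj
      rw [Finset.mem_filter, Finset.mem_range]
      exact ⟨by omega, hp j i (by omega) hi h⟩
    have := Finset.card_le_card this
    rwa [Finset.card_range] at this

/-- The number of cubes `[x, x + 1] × [y, y + 1] × [z - 1, z]`, `0 ≤ y < a`, in the pile with height
function `H`. -/
def pileDepth (a : ℕ) (H : ℤ → ℤ → ℕ) (x z : ℤ) : ℕ :=
  ((Finset.range a).filter fun y : ℕ => z ≤ H (x - z + 1) (y - z + 1)).card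

theorem pileDepth_le (a : ℕ) (H : ℤ → ℤ → ℕ) (x z : ℤ) : pileDepth a H x z ≤ a :=
  (Finset.card_filter_le _ _).trans_eq (Finset.card_range a)

namespace IsHeightFunction

variable {a b c : ℕ} {H : ℤ → ℤ → ℕ}

/-- Columns in the `y`-direction have no gaps. The ranges include the empty columns `x = b` and `z =
c + 1`, which provide the boundary values of the passage times. -/
theorem lt_pileDepth_iff (hH : IsHeightFunction a b c H) {x z : ℤ} (hx : 0 ≤ x) (hxb : x ≤ b)
    (hz : 1 ≤ z) (hzc : z ≤ c + 1) {y : ℕ} (hy : y < a) :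
    y < pileDepth a H x z ↔ z ≤ H (x - z + 1) (y - z + 1) := by
  refine lt_card_filter_range_iff (p := fun y : ℕ => z ≤ H (x - z + 1) (y - z + 1)) hy ?_
  intro j k hjk hk h
  induction k, hjk using Nat.le_induction with
  | base => exact h
  | succ k hjk ih =>
    have e : ((k + 1 : ℕ) : ℤ) - z + 1 = (k - z + 1) + 1 := by push_cast; ring
    refine ih (by omega) ?_
    rw [e] at h
    have := hH.y_le (u := x - z + 1) (v := k - z + 1) (by rw [mem_hexagon]; omega)
      (by rw [mem_hexagon]; omega)
    omega

theorem pileDepth_x_le (hH : IsHeightFunction a b c H) {x z : ℤ} (hx : 0 ≤ x) (hxb : x < b)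
    (hz : 1 ≤ z) (hzc : z ≤ c + 1) : pileDepth a H (x + 1) z ≤ pileDepth a H x z := by
  refine Finset.card_le_card fun y hy => ?_
  rw [Finset.mem_filter, Finset.mem_range] at *
  refine ⟨hy.1, ?_⟩
  have := hH.x_le (u := x - z + 1) (v := y - z + 1) (by rw [mem_hexagon]; omega)
    (by rw [mem_hexagon]; omega)
  rw [show x + 1 - z + 1 = x - z + 1 + 1 by ring] at hy
  omega

theorem pileDepth_z_le (hH : IsHeightFunction a b c H) {x z : ℤ} (hx : 0 ≤ x) (hxb : x ≤ b)
    (hz : 1 ≤ z) (hzc : z ≤ c) : pileDepth a H x (z + 1) ≤ pileDepth a H x z := by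
  refine Finset.card_le_card fun y hy => ?_
  rw [Finset.mem_filter, Finset.mem_range] at *
  refine ⟨hy.1, ?_⟩
  have := hH.diag_le (u := x - z) (v := y - z) (by rw [mem_hexagon]; omega)
    (by rw [mem_hexagon]; omega)
  rw [show x - (z + 1) + 1 = x - z by ring, show (y : ℤ) - (z + 1) + 1 = y - z by ring] at hy
  omega

theorem pileDepth_eq_zero (hH : IsHeightFunction a b c H) {x z : ℤ} (hx : 0 ≤ x) (hxb : x ≤ b)
    (hz : 1 ≤ z) (hzc : z ≤ c + 1) (h : x = b ∨ z = c + 1) : pileDepth a H x z = 0 := by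
  refine Finset.card_eq_zero.2 (Finset.filter_eq_empty_iff.2 fun y hy hle => ?_)
  rw [Finset.mem_range] at hy
  have hm : (x - z + 1, y - z + 1) ∈ hexagon a b c := by rw [mem_hexagon]; omega
  have h1 := hH.le_b hm
  have h2 := hH.le_c hm
  omega

theorem le_of_pileDepth_eq {H' : ℤ → ℤ → ℕ} (hH : IsHeightFunction a b c H)
    (hH' : IsHeightFunction a b c H')
    (h : ∀ x z : ℤ, 0 ≤ x → x < b → 1 ≤ z → z ≤ c → pileDepth a H x z = pileDepth a H' x z)
    {u v : ℤ} (huv : (u, v) ∈ hexagon a b c) : H u v ≤ H' u v := by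
  have h1 := hH.le_c huv
  have h2 := hH.le_b huv
  have h3 := hH.le_a huv
  have h4 := hH'.ge_u huv
  have h5 := hH'.ge_v huv
  by_contra hlt
  -- The cube whose outer vertex is the surface point of `H` drawn at `(u, v)`; it would lie in the
  -- pile of `H` but not in that of `H'`.
  obtain ⟨y, hy⟩ : ∃ y : ℕ, v + H u v - 1 = y := ⟨(v + H u v - 1).toNat, by omega⟩
  have k1 := hH.lt_pileDepth_iff (x := u + H u v - 1) (z := H u v) (y := y) (by omega) (by omega)
    (by omega) (by omega) (by omega)
  have k2 := hH'.lt_pileDepth_iff (x := u + H u v - 1) (z := H u v) (y := y) (by omega) (by omega)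
    (by omega) (by omega) (by omega)
  rw [h _ _ (by omega) (by omega) (by omega) (by omega), k2, ← hy] at k1
  rw [show u + H u v - 1 - H u v + 1 = u by ring,
    show v + H u v - 1 - H u v + 1 = v by ring] at k1
  have := k1.2 le_rfl
  omega

end IsHeightFunction

/-- The number of left corners of the surface with height function `H` at the edges with the given
`x`- and `z`-coordinates. -/
def cornerMatrix (a b c : ℕ) (H : ℤ → ℤ → ℕ) (t n : ℕ) : ℕ :=
  if t < c ∧ n < b then pileDepth a H (b - 1 - n) (c - t) -
    max (pileDepth a H (b - n) (c - t)) (pileDepth a H (b - 1 - n) (c - t + 1)) else 0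

/-- Both sides vanish at the boundary and obey the same recursion. Depths decrease in `x` and `z`,
so the truncated subtraction in `cornerMatrix` is exact. -/
theorem IsHeightFunction.lpp_cornerMatrix {a b c : ℕ} {H : ℤ → ℤ → ℕ}
    (hH : IsHeightFunction a b c H) {t n : ℕ} (ht : t ≤ c) (hn : n ≤ b) :
    lpp (cornerMatrix a b c H) t n = pileDepth a H (b - n) (c + 1 - t) := by
  induction t generalizing n with
  | zero =>
    rw [hH.pileDepth_eq_zero (by omega) (by omega) (by omega) (by omega) (by right; simp)]
    rfl
  | succ t iht =>
    induction n with
    | zero =>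
      rw [hH.pileDepth_eq_zero (by omega) (by omega) (by omega) (by omega) (by left; simp)]
      rfl
    | succ n ihn =>
      rw [lpp_succ_succ, ihn (by omega), iht (by omega) hn, cornerMatrix,
        if_pos ⟨by omega, by omega⟩]
      have h1 := hH.pileDepth_x_le (x := b - 1 - n) (z := c - t) (by omega) (by omega) (by omega)
        (by omega)
      have h2 := hH.pileDepth_z_le (x := b - 1 - n) (z := c - t) (by omega) (by omega) (by omega)
        (by omega)
      push_cast
      rw [show (b : ℤ) - 1 - n + 1 = b - n by ring] at h1
      rw [show (c : ℤ) - t + 1 = c + 1 - t by ring] at *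
      rw [show (c : ℤ) + 1 - (t + 1) = c - t by ring, show (b : ℤ) - (n + 1) = b - 1 - n by ring]
      omega

theorem IsHeightFunction.cornerMatrix_mem {a b c : ℕ} {H : ℤ → ℤ → ℕ}
    (hH : IsHeightFunction a b c H) : cornerMatrix a b c H ∈ lppMatrices a b c := by
  refine ⟨fun t n h => if_neg (by omega), ?_⟩
  rw [hH.lpp_cornerMatrix le_rfl le_rfl]
  exact pileDepth_le _ _ _ _

theorem IsLozengeTiling.cornerCount_eq {a b c : ℕ} {T : Finset Lozenge}
    (hT : IsLozengeTiling a b c T) {t : ℕ} (ht : t < c) :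
    cornerCount a b c (c - t) T =
      ∑ n ∈ Finset.range b, cornerMatrix a b c (vertexHeight a b c T) t n := by
  have hH := hT.isHeightFunction
  set H := vertexHeight a b c T with hHdef
  let lo : ℕ → ℕ := fun n =>
    max (pileDepth a H (b - n) (c - t)) (pileDepth a H (b - 1 - n) (c - t + 1))
  let hi : ℕ → ℕ := fun n => pileDepth a H (b - 1 - n) (c - t)
  let S : Finset (Σ _ : ℕ, ℕ) := (Finset.range b).sigma fun n => Finset.Ico (lo n) (hi n)
  -- The top face of the cube at `x = b - 1 - n`, `y`, `z = c - t` is drawn here. It carries a left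
  -- corner exactly when the cube is in the pile but its neighbours at `x + 1` and at `z + 1` are
  -- not, that is, when `lo n ≤ y < hi n`.
  let f : (Σ _ : ℕ, ℕ) → ℤ × ℤ := fun q => (b - 1 - q.1 - (c - t), q.2 - (c - t))
  have hf : Function.Injective f := by
    rintro ⟨n, y⟩ ⟨n', y'⟩ h
    simp only [f, Prod.mk.injEq] at h
    obtain rfl : n = n' := by omega
    obtain rfl : y = y' := by omega
    rfl
  have hS : {p : ℤ × ℤ | IsLeftCorner T p ∧ topHeight a b c T p.1 p.2 = c - t} = f '' S := by
    ext ⟨u, v⟩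
    simp only [Set.mem_ofPred_eq, Set.mem_image, IsLeftCorner, topHeight_eq_vertexHeight, ← hHdef]
    have e1 : (c : ℤ) - t = ((c - t : ℕ) : ℤ) := by omega
    constructor
    · rintro ⟨⟨htop, hleft⟩, hz⟩
      rw [hT.eq_surfaceTiling, mem_surfaceTiling, ← hHdef] at htop hleft
      obtain ⟨m1, m2, m3, m4, htop⟩ := htop
      obtain ⟨m5, m6, m7, m8, hleft⟩ := hleft
      have k1 := hH.ge_u m1
      have k2 := hH.ge_v m1
      have k3 := hH.le_b m4
      have k4 := hH.le_a m4
      obtain ⟨n, hn⟩ : ∃ n : ℕ, (n : ℤ) = b - 1 - u - (c - t) :=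
        ⟨(b - 1 - u - (c - t)).toNat, by omega⟩
      obtain ⟨y, hy⟩ : ∃ y : ℕ, (y : ℤ) = v + (c - t) := ⟨(v + (c - t)).toNat, by omega⟩
      have i1 := hH.lt_pileDepth_iff (x := b - 1 - n) (z := c - t) (y := y) (by omega) (by omega)
        (by omega) (by omega) (by omega)
      have i2 := hH.lt_pileDepth_iff (x := b - n) (z := c - t) (y := y) (by omega) (by omega)
        (by omega) (by omega) (by omega)
      have i3 := hH.lt_pileDepth_iff (x := b - 1 - n) (z := c - t + 1) (y := y) (by omega)
        (by omega) (by omega) (by omega) (by omega)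
      rw [show (b : ℤ) - 1 - n - (c - t) + 1 = u + 1 by omega,
        show (y : ℤ) - (c - t) + 1 = v + 1 by omega] at i1
      rw [show (b : ℤ) - n - (c - t) + 1 = u + 1 + 1 by omega,
        show (y : ℤ) - (c - t) + 1 = v + 1 by omega] at i2
      rw [show (b : ℤ) - 1 - n - (c - t + 1) + 1 = u by omega,
        show (y : ℤ) - (c - t + 1) + 1 = v by omega] at i3
      refine ⟨⟨n, y⟩, ?_, ?_⟩
      · simp only [S, Finset.coe_sigma, Set.mem_sigma_iff, Finset.coe_range, Set.mem_Iio,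
          Finset.coe_Ico, Set.mem_Ico, lo, hi]
        omega
      · simp only [f, Prod.mk.injEq]
        omega
    · rintro ⟨⟨n, y⟩, hm, he⟩
      simp only [S, Finset.coe_sigma, Set.mem_sigma_iff, Finset.coe_range, Set.mem_Iio,
        Finset.coe_Ico, Set.mem_Ico, lo, hi] at hm
      simp only [f, Prod.mk.injEq] at he
      obtain ⟨hn, hlo, hhi⟩ := hm
      have hya : y < a := hhi.trans_le (pileDepth_le _ _ _ _)
      have i1 := hH.lt_pileDepth_iff (x := b - 1 - n) (z := c - t) (y := y) (by omega) (by omega)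
        (by omega) (by omega) (by omega)
      have i2 := hH.lt_pileDepth_iff (x := b - n) (z := c - t) (y := y) (by omega) (by omega)
        (by omega) (by omega) (by omega)
      have i3 := hH.lt_pileDepth_iff (x := b - 1 - n) (z := c - t + 1) (y := y) (by omega)
        (by omega) (by omega) (by omega) (by omega)
      rw [show (b : ℤ) - 1 - n - (c - t) + 1 = u + 1 by omega,
        show (y : ℤ) - (c - t) + 1 = v + 1 by omega] at i1
      rw [show (b : ℤ) - n - (c - t) + 1 = u + 1 + 1 by omega,
        show (y : ℤ) - (c - t) + 1 = v + 1 by omega] at i2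
      rw [show (b : ℤ) - 1 - n - (c - t + 1) + 1 = u by omega,
        show (y : ℤ) - (c - t + 1) + 1 = v by omega] at i3
      have m1 : (u, v) ∈ hexagon a b c := by rw [mem_hexagon]; omega
      have m2 : (u + 1, v) ∈ hexagon a b c := by rw [mem_hexagon]; omega
      have m3 : (u, v + 1) ∈ hexagon a b c := by rw [mem_hexagon]; omega
      have m4 : (u + 1, v + 1) ∈ hexagon a b c := by rw [mem_hexagon]; omega
      have m5 : (u + 1 + 1, v + 1) ∈ hexagon a b c := by rw [mem_hexagon]; omega
      have m6 : (u + 1 + 1, v + 2) ∈ hexagon a b c := by rw [mem_hexagon]; omega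
      have l1 := hH.x_le m1 m2
      have l2 := hH.y_le m2 m4
      have l3 := hH.x_le m4 m5
      have l4 := hT.vertexHeight_eq_add_left m4 m5
      have l5 := lozengeCount_le_one T (.left (u + 1) (v + 1 - 1))
      rw [← hHdef] at l4
      rw [hT.eq_surfaceTiling, mem_surfaceTiling, mem_surfaceTiling, ← hHdef]
      exact ⟨⟨⟨m1, m2, m3, m4, by omega⟩, m2, m4, m5, m6, by omega⟩, by omega⟩
  rw [cornerCount, hS, Set.ncard_image_of_injective _ hf, Set.ncard_coe_finset, Finset.card_sigma]
  refine Finset.sum_congr rfl fun n hn => ?_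
  rw [Nat.card_Ico, cornerMatrix, if_pos ⟨ht, Finset.mem_range.1 hn⟩]

/-! ### From matrices back to piles -/

/-- The condition for the cube `[x, x + 1] × [y, y + 1] × [z - 1, z]` whose outer vertex is drawn at
`(u, v)` to lie behind the walls or in the pile that is described by the last passage times of
`W`. -/
def InPile (a b c : ℕ) (W : ℕ → ℕ → ℕ) (u v z : ℤ) : Prop :=
  z ≤ -u ∨ z ≤ -v ∨ (z ≤ b - u ∧ z ≤ a - v ∧
    v + z - 1 < lpp W (c + 1 - z).toNat (b - (u + z - 1)).toNat)

open Classical in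
/-- The height function of the pile that is described by the last passage times of `W`. -/
noncomputable def pileHeight (a b c : ℕ) (W : ℕ → ℕ → ℕ) (u v : ℤ) : ℕ :=
  ((Finset.range c).filter fun i : ℕ => InPile a b c W u v (i + 1)).card

theorem lpp_le_lpp (W : ℕ → ℕ → ℕ) {t t' n n' : ℕ} (ht : t ≤ t') (hn : n ≤ n') :
    lpp W t n ≤ lpp W t' n' :=
  (lpp_mono_right W t hn).trans (lpp_mono_left W n' ht)

theorem InPile.of_le {a b c : ℕ} {W : ℕ → ℕ → ℕ} {u v z z' : ℤ} (h : InPile a b c W u v z)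
    (hz : z' ≤ z) : InPile a b c W u v z' := by
  have := lpp_le_lpp W (t := (c + 1 - z).toNat) (t' := (c + 1 - z').toNat)
    (n := (b - (u + z - 1)).toNat) (n' := (b - (u + z' - 1)).toNat) (by omega) (by omega)
  unfold InPile at *
  omega

theorem lt_pileHeight_iff {a b c : ℕ} {W : ℕ → ℕ → ℕ} {u v : ℤ} {i : ℕ} (hi : i < c) :
    i < pileHeight a b c W u v ↔ InPile a b c W u v (i + 1) := by
  classical
  exact lt_card_filter_range_iff (p := fun i : ℕ => InPile a b c W u v (i + 1)) hi
    fun j k hjk _ h => h.of_le (by omega)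

theorem pileHeight_le_c (a b c : ℕ) (W : ℕ → ℕ → ℕ) (u v : ℤ) : pileHeight a b c W u v ≤ c := by
  classical
  exact (Finset.card_filter_le _ _).trans_eq (Finset.card_range c)

theorem pileHeight_mono {a b c : ℕ} {W : ℕ → ℕ → ℕ} {u v u' v' : ℤ}
    (h : ∀ z : ℤ, InPile a b c W u v z → InPile a b c W u' v' z) :
    pileHeight a b c W u v ≤ pileHeight a b c W u' v' := by
  classical
  exact Finset.card_le_card (Finset.monotone_filter_right _ fun i _ hi => h _ hi)

theorem isHeightFunction_pileHeight (a b c : ℕ) (W : ℕ → ℕ → ℕ) :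
    IsHeightFunction a b c (pileHeight a b c W) where
  x_le {u v} h h' := pileHeight_mono fun z hz => by
    have := lpp_le_lpp W (t := (c + 1 - z).toNat) (t' := (c + 1 - z).toNat)
      (n := (b - (u + 1 + z - 1)).toNat) (n' := (b - (u + z - 1)).toNat) le_rfl (by omega)
    unfold InPile at *
    omega
  y_le {u v} h h' := pileHeight_mono fun z hz => by
    unfold InPile at *
    omega
  diag_le {u v} h h' := by
    by_contra hlt
    have hc := pileHeight_le_c a b c W u v
    set m := pileHeight a b c W (u + 1) (v + 1) with hm
    have h1 := (lt_pileHeight_iff (a := a) (b := b) (c := c) (W := W) (u := u) (v := v)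
      (i := m + 1) (by omega)).1 (by omega)
    have h2 := (lt_pileHeight_iff (a := a) (b := b) (c := c) (W := W) (u := u + 1) (v := v + 1)
      (i := m) (by omega)).not.1 (by omega)
    -- The cubes at level `m + 2` over `(u, v)` and at level `m + 1` over `(u + 1, v + 1)` have the
    -- same `x` and `y`, so monotonicity in the row index suffices.
    have := lpp_le_lpp W (t := (c + 1 - ((m + 1 : ℕ) + 1 : ℤ)).toNat)
      (t' := (c + 1 - (m + 1 : ℤ)).toNat)
      (n := (b - (u + ((m + 1 : ℕ) + 1 : ℤ) - 1)).toNat)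
      (n' := (b - (u + 1 + (m + 1 : ℤ) - 1)).toNat) (by omega) (by omega)
    unfold InPile at *
    omega
  le_c h := pileHeight_le_c _ _ _ _ _ _
  le_b {u v} h := by
    by_contra hlt
    rw [mem_hexagon] at h
    have hc := pileHeight_le_c a b c W u v
    have h1 := (lt_pileHeight_iff (a := a) (b := b) (c := c) (W := W) (u := u) (v := v)
      (i := (b - u).toNat) (by omega)).1 (by omega)
    unfold InPile at h1
    omega
  le_a {u v} h := by
    by_contra hlt
    rw [mem_hexagon] at h
    have hc := pileHeight_le_c a b c W u v
    have h1 := (lt_pileHeight_iff (a := a) (b := b) (c := c) (W := W) (u := u) (v := v)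
      (i := (a - v).toNat) (by omega)).1 (by omega)
    unfold InPile at h1
    omega
  ge_u {u v} h := by
    by_contra hlt
    rw [mem_hexagon] at h
    have h1 := (lt_pileHeight_iff (a := a) (b := b) (c := c) (W := W) (u := u) (v := v)
      (i := (-u - 1).toNat) (by omega)).2 (Or.inl (by omega))
    omega
  ge_v {u v} h := by
    by_contra hlt
    rw [mem_hexagon] at h
    have h1 := (lt_pileHeight_iff (a := a) (b := b) (c := c) (W := W) (u := u) (v := v)
      (i := (-v - 1).toNat) (by omega)).2 (Or.inr (Or.inl (by omega)))
    omega

/-- The bound `hW` makes every passage time fit into the `a` available cubes of its column. -/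
theorem pileDepth_pileHeight {a b c : ℕ} {W : ℕ → ℕ → ℕ} (hW : lpp W c b ≤ a) {t n : ℕ}
    (ht : t ≤ c) (hn : n ≤ b) :
    pileDepth a (pileHeight a b c W) (b - n) (c + 1 - t) = lpp W t n := by
  have hH := isHeightFunction_pileHeight a b c W
  rcases t with _ | t
  · rw [hH.pileDepth_eq_zero (by omega) (by omega) (by omega) (by omega) (by right; simp)]
    rfl
  rcases n with _ | n
  · rw [hH.pileDepth_eq_zero (by omega) (by omega) (by omega) (by omega) (by left; simp)]
    rfl
  have hle : lpp W (t + 1) (n + 1) ≤ a := (lpp_le_lpp W ht hn).trans hW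
  have key : ∀ y < a, y < pileDepth a (pileHeight a b c W) (b - (n + 1 : ℕ)) (c + 1 - (t + 1 : ℕ)) ↔
      y < lpp W (t + 1) (n + 1) := by
    intro y hy
    rw [hH.lt_pileDepth_iff (by omega) (by omega) (by omega) (by omega) hy]
    have h1 := lt_pileHeight_iff (a := a) (b := b) (c := c) (W := W)
      (u := b - (n + 1 : ℕ) - (c + 1 - (t + 1 : ℕ)) + 1) (v := y - (c + 1 - (t + 1 : ℕ)) + 1)
      (i := c - t - 1) (show c - t - 1 < c by omega)
    have e1 : (((c - t - 1 : ℕ) : ℤ) + 1) = c - t := by omega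
    rw [e1, InPile, show ((c : ℤ) + 1 - (c - t)).toNat = t + 1 by omega,
      show ((b : ℤ) - (b - (n + 1 : ℕ) - (c + 1 - (t + 1 : ℕ)) + 1 + (c - t) - 1)).toNat = n + 1 by
        omega] at h1
    omega
  have h1 := pileDepth_le a (pileHeight a b c W) (b - (n + 1 : ℕ)) (c + 1 - (t + 1 : ℕ))
  refine le_antisymm (not_lt.1 fun h => ?_) (not_lt.1 fun h => ?_)
  · have := (key _ (by omega)).1 h
    omega
  · have := (key _ (by omega)).2 h
    omega

theorem pileDepth_congr {a b c : ℕ} {H H' : ℤ → ℤ → ℕ}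
    (h : ∀ u v, (u, v) ∈ hexagon a b c → H u v = H' u v) {x z : ℤ} (hx : 0 ≤ x) (hxb : x ≤ b)
    (hz : 1 ≤ z) (hzc : z ≤ c + 1) : pileDepth a H x z = pileDepth a H' x z := by
  unfold pileDepth
  congr 1
  refine Finset.filter_congr fun y hy => ?_
  rw [Finset.mem_range] at hy
  rw [h _ _ (by rw [mem_hexagon]; omega)]

/-- The weights are recovered from passage times by solving the recursion for `W t n`. Agreement on
the hexagon is all that is asked of `H`, since the height of a surface tiling is controlled only
there. -/
theorem cornerMatrix_pileHeight {a b c : ℕ} {W : ℕ → ℕ → ℕ} (hW : W ∈ lppMatrices a b c)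
    {H : ℤ → ℤ → ℕ} (hH : ∀ u v, (u, v) ∈ hexagon a b c → H u v = pileHeight a b c W u v) :
    cornerMatrix a b c H = W := by
  funext t n
  by_cases htn : t < c ∧ n < b
  · rw [cornerMatrix, if_pos htn]
    have e1 := pileDepth_pileHeight hW.2 (t := t + 1) (n := n + 1) htn.1 htn.2
    have e2 := pileDepth_pileHeight hW.2 (t := t + 1) (n := n) htn.1 htn.2.le
    have e3 := pileDepth_pileHeight hW.2 (t := t) (n := n + 1) htn.1.le htn.2
    push_cast at e1 e2 e3
    rw [show (c : ℤ) + 1 - (t + 1) = c - t by ring] at e1 e2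
    rw [show (b : ℤ) - (n + 1) = b - 1 - n by ring] at e1 e3
    rw [show (c : ℤ) + 1 - t = c - t + 1 by ring] at e3
    rw [pileDepth_congr hH (by omega) (by omega) (by omega) (by omega),
      pileDepth_congr hH (by omega) (by omega) (by omega) (by omega),
      pileDepth_congr hH (by omega) (by omega) (by omega) (by omega), e1, e2, e3, lpp_succ_succ]
    omega
  · rw [cornerMatrix, if_neg htn, hW.1 t n (by omega)]

theorem bijOn_cornerMatrix (a b c : ℕ) :
    Set.BijOn (fun T => cornerMatrix a b c (vertexHeight a b c T)) (lozengeTilings a b c)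
      (lppMatrices a b c) := by
  refine ⟨fun T hT => (IsLozengeTiling.isHeightFunction hT).cornerMatrix_mem,
    fun T hT T' hT' h => ?_, fun W hW => ?_⟩
  · change IsLozengeTiling a b c T at hT
    change IsLozengeTiling a b c T' at hT'
    have hd : ∀ x z : ℤ, 0 ≤ x → x < b → 1 ≤ z → z ≤ c →
        pileDepth a (vertexHeight a b c T) x z = pileDepth a (vertexHeight a b c T') x z := by
      intro x z hx hxb hz hzc
      have h1 := hT.isHeightFunction.lpp_cornerMatrix (t := (c + 1 - z).toNat)
        (n := (b - x).toNat) (by omega) (by omega)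
      have h2 := hT'.isHeightFunction.lpp_cornerMatrix (t := (c + 1 - z).toNat)
        (n := (b - x).toNat) (by omega) (by omega)
      rw [show (b : ℤ) - ((b - x).toNat : ℕ) = x by omega,
        show (c : ℤ) + 1 - ((c + 1 - z).toNat : ℕ) = z by omega] at h1 h2
      rw [← h1, ← h2]
      exact congrArg (fun W => lpp W _ _) h
    rw [hT.eq_surfaceTiling, hT'.eq_surfaceTiling]
    exact surfaceTiling_congr fun u v huv => le_antisymm
      (hT.isHeightFunction.le_of_pileDepth_eq hT'.isHeightFunction hd huv)
      (hT'.isHeightFunction.le_of_pileDepth_eq hT.isHeightFunction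
        (fun x z h1 h2 h3 h4 => (hd x z h1 h2 h3 h4).symm) huv)
  · have hH := isHeightFunction_pileHeight a b c W
    exact ⟨surfaceTiling a b c (pileHeight a b c W), hH.isLozengeTiling,
      cornerMatrix_pileHeight hW fun u v huv => hH.vertexHeight_surfaceTiling huv⟩

/-! ### Corner vectors as row sums, and the conclusion -/

theorem IsLozengeTiling.cornerVector_eq_iff {a b c k : ℕ} (hkc : k ≤ c) {T : Finset Lozenge}
    (hT : IsLozengeTiling a b c T) (v : Fin k → ℕ) :
    cornerVector a b c k T = v ↔ ∀ i : Fin k, ∑ n ∈ Finset.range b,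
      cornerMatrix a b c (vertexHeight a b c T) (c - 1 - i) n = v i := by
  rw [funext_iff]
  refine forall_congr' fun i => ?_
  have hi := i.2
  rw [← hT.cornerCount_eq (by omega), cornerVector, show c - (c - 1 - i) = (i : ℕ) + 1 by omega]

theorem ncard_cornerVector_eq {a b c k : ℕ} (hkc : k ≤ c) (v : Fin k → ℕ) :
    (lozengeTilings a b c ∩ {T | cornerVector a b c k T = v}).ncard =
      (rowSumMatrices a b c v).ncard := by
  have hbij := bijOn_cornerMatrix a b c
  rw [← (hbij.injOn.mono Set.inter_subset_left).ncard_image]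
  congr 1
  ext W
  constructor
  · rintro ⟨T, ⟨hT, hv⟩, rfl⟩
    exact ⟨hbij.mapsTo hT, (IsLozengeTiling.cornerVector_eq_iff hkc hT v).1 hv⟩
  · rintro ⟨hW, hv⟩
    obtain ⟨T, hT, rfl⟩ := hbij.surjOn hW
    exact ⟨T, ⟨hT, (IsLozengeTiling.cornerVector_eq_iff hkc hT v).2 hv⟩, rfl⟩

theorem mainTheorem8 (a b c k : ℕ) (ha : 0 < a) (hb : 0 < b) (hc : 0 < c) (hkc : k ≤ c)
    (α β : Fin k → ℕ) (σ τ : Equiv.Perm (Fin k))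
    (hα : Antitone (α ∘ σ)) (hdom : Dominates (β ∘ τ) (α ∘ σ)) :
    tilingMeasure a b c {T | cornerVector a b c k T = α} ≥
      tilingMeasure a b c {T | cornerVector a b c k T = β} := by
  have hfin := lozengeTilings_finite a b c
  have hle := ncard_rowSumMatrices_le_of_dominates (a := a) hb hkc hα hdom
  rw [← ncard_cornerVector_eq hkc, ← ncard_cornerVector_eq hkc] at hle
  have hcount : ∀ s : Set (Finset Lozenge), Measure.count (lozengeTilings a b c ∩ s) =
      ((lozengeTilings a b c ∩ s).ncard : ENNReal) := by
    intro s
    rw [Measure.count_apply (MeasurableSet.of_discrete),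
      ← (hfin.subset Set.inter_subset_left).cast_ncard_eq]
    simp
  rw [ge_iff_le, tilingMeasure, uniformOn, cond_apply (MeasurableSet.of_discrete),
    cond_apply (MeasurableSet.of_discrete), hcount, hcount]
  gcongr
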